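/- Let $M_\#$ be a smooth manifold of dimension $2n+1$ with a contact structure $H\subset TM_\#$, i.e. a smooth distribution of rank $2n$ such that, with $Q:=TM_\#/H$, the Levi bracket $\mathcal L:\Lambda^2H\to Q$ induced by the Lie bracket of vector fields is non-degenerate in each point. Let $\xi$ be a transversal infinitesimal automorphism, i.e. a smooth vector field with $\xi(x)\notin H_x$ for all $x$ and $[\xi,\eta]\in\Gamma(H)$ for all (local) sections $\eta\in\Gamma(H)$ (equivalently, the local flow of $\xi$ preserves $H$). Let $q:M_\#\to M$ be a quotient by $\xi$, i.e. a surjective submersion with connected fibers onto a smooth manifold $M$ of dimension $2n$ such that $\ker T_xq=\mathbb R\,\xi(x)$ for all $x\in M_\#$. Notation. $\Lambda^k_0H^*\subset\Lambda^kH^*$ is the kernel of the insertion of $\mathcal L^{-1}\in\Lambda^2H\otimes Q^*$ for $k\le n$, and the kernel of the wedge product with $\mathcal L$ for $k>n$. Via the isomorphisms $T_xq:H_x\to T_{q(x)}M$, the Levi bracket determines a line subbundle $\ell\subset\Lambda^2T^*M$ (for $n\ge 1$), and $\Lambda^k_0T^*M\subset\Lambda^kT^*M$ is defined in the same way from the inclusion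 $\ell\hookrightarrow\Lambda^2T^*M$, viewed as a section $\mathbf\Omega$ of $\Lambda^2T^*M\otimes\ell^*$: the kernel of the insertion of $\mathbf\Omega^{-1}$ for $k\le n$ and the kernel of the wedge product with $\mathbf\Omega$ for $k>n$. $\Omega^k_0(M)$ is the space of smooth sections of $\Lambda^k_0T^*M$. $\Lambda^kH^*\otimes Q^*$ is viewed as the subbundle of $\Lambda^{k+1}T^*M_\#$ of those forms which vanish if all their entries are from $H$; here $\psi$ corresponds to the map sending $h_1,\dots,h_k\in H_x$ and the class of $u\in T_xM_\#$ in $Q_x$ to $\psi(u,h_1,\dots,h_k)$. $L_\xi$ denotes the Lie derivative along $\xi$ on each of the spaces of sections below, and $\Omega^{-1}(M)=0$. Then there is a unique contact form $\alpha$ on $M_\#$ (a smooth one-form with kernel $H$) such that $\alpha(\xi)=1$, and for every $k\ge 0$ the following linear maps are isomorphisms onto the indicated kernels: 1. $\Omega^k(M)\to\ker(L_\xi)\subset\Gamma(\Lambda^kH^*)$, $\varphi\mapsto q^*\varphi|_{\Lambda^kH}$; 2. $\Omega^k_0(M)\to\ker(L_\xi)\subset\Gamma(\Lambda^k_0H^*)$,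 $\varphi\mapsto q^*\varphi|_{\Lambda^kH}$; 3. $\Omega^k(M)\to\ker(L_\xi)\subset\Gamma(\Lambda^kH^*\otimes Q^*)$, $\varphi\mapsto\alpha\wedge q^*\varphi$; 4. $\Omega^k_0(M)\to\ker(L_\xi)\subset\Gamma(\Lambda^k_0H^*\otimes Q^*)$, $\varphi\mapsto\alpha\wedge q^*\varphi$; 5. $\Omega^k(M)\oplus\Omega^{k-1}(M)\to\ker(L_\xi)\subset\Omega^k(M_\#)$, $(\varphi_1,\varphi_2)\mapsto q^*\varphi_1+\alpha\wedge q^*\varphi_2$. -/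

import Mathlib

open scoped Manifold ContDiff Topology TensorProduct

noncomputable section

namespace ContactQuotient

/-! ### Linear algebra: wedging with a two-form and inserting its inverse -/

section LinearAlgebra

variable {V W : Type*} [AddCommGroup V] [Module ℝ V] [AddCommGroup W] [Module ℝ W]

/-- The linear map `V → Hom(V, W)`, `u ↦ B(u, ·)`, of a `W`-valued two-form `B` on `V`. -/
def flat (B : V [⋀^Fin 2]→ₗ[ℝ] W) : V →ₗ[ℝ] V →ₗ[ℝ] W :=
  LinearMap.mk₂ ℝ (fun u w => B ![u, w])
    (fun u u' _ => B.map_vecCons_add _ u u')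
    (fun c u _ => B.map_vecCons_smul _ c u)
    (fun u w w' => (B.curryLeft u).map_vecCons_add ![] w w')
    (fun c u w => (B.curryLeft u).map_vecCons_smul ![] c w)

/-- Non-degeneracy of a `W`-valued two-form: `B(u, ·) = 0` only for `u = 0`. -/
def Nondegenerate (B : V [⋀^Fin 2]→ₗ[ℝ] W) : Prop :=
  ∀ u : V, (∀ w : V, B ![u, w] = 0) → u = 0

open Classical in
/-- The inverse `B⁻¹ : Hom(V, W) = V* ⊗ W → V` of `u ↦ B(u, ·)`. If `W` is a line and `V` is finite
dimensional, then it exists if and only if `B` is non-degenerate, and it corresponds to an element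
of `Λ²V ⊗ W*`. (The value `0` is used if there is no inverse.) -/
def flatInv (B : V [⋀^Fin 2]→ₗ[ℝ] W) : (V →ₗ[ℝ] W) →ₗ[ℝ] V :=
  if h : Function.Bijective (flat B) then ((LinearEquiv.ofBijective (flat B) h).symm).toLinearMap
  else 0

/-- For a `(k+2)`-form `φ`, vectors `v₁, …, v_k` and `s ∈ W`, the map
`V → Hom(V, W)`, `u ↦ (w ↦ φ(u, w, v₁, …, v_k) s)`. -/
def slots {k : ℕ} (φ : V [⋀^Fin (k + 2)]→ₗ[ℝ] ℝ) (v : Fin k → V) (s : W) :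
    V →ₗ[ℝ] V →ₗ[ℝ] W :=
  LinearMap.mk₂ ℝ (fun u w => φ (Matrix.vecCons u (Matrix.vecCons w v)) • s)
    (fun u u' w => by rw [φ.map_vecCons_add, add_smul])
    (fun c u w => by rw [φ.map_vecCons_smul, smul_assoc])
    (fun u w w' => by
      have h := (φ.curryLeft u).map_vecCons_add v w w'
      simp only [AlternatingMap.curryLeft_apply_apply] at h
      rw [h, add_smul])
    (fun c u w => by
      have h := (φ.curryLeft u).map_vecCons_smul v c w
      simp only [AlternatingMap.curryLeft_apply_apply] at h
      rw [h, smul_assoc])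

/-- The insertion of `B⁻¹ ∈ Λ²V ⊗ W*` into a `(k+2)`-form `φ`, giving an element of `Λᵏ V* ⊗ W*`
(evaluated on `v₁, …, v_k ∈ V` and `s ∈ W`): the first two entries of `φ` are contracted with `B⁻¹`.
In a basis `(e_a)` of `V` and, for `W = ℝ s`, with `B(e_a, e_b) = B_ab s`, it is, for the inverse
matrix `(Bᵃᵇ)` of `(B_ab)`, the expression `∑ Bᵇᵃ φ(e_a, e_b, v₁, …, v_k)`. -/
def insertInv (B : V [⋀^Fin 2]→ₗ[ℝ] W) {k : ℕ} (φ : V [⋀^Fin (k + 2)]→ₗ[ℝ] ℝ)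
    (v : Fin k → V) (s : W) : ℝ :=
  LinearMap.trace ℝ V (flatInv B ∘ₗ slots φ v s)

theorem slots_zero {k : ℕ} (v : Fin k → V) (s : W) :
    slots (0 : V [⋀^Fin (k + 2)]→ₗ[ℝ] ℝ) v s = 0 := by
  ext u w; simp [slots]

theorem slots_add {k : ℕ} (φ ψ : V [⋀^Fin (k + 2)]→ₗ[ℝ] ℝ) (v : Fin k → V) (s : W) :
    slots (φ + ψ) v s = slots φ v s + slots ψ v s := by
  ext u w; simp [slots, add_smul]

theorem slots_smul {k : ℕ} (c : ℝ) (φ : V [⋀^Fin (k + 2)]→ₗ[ℝ] ℝ) (v : Fin k → V) (s : W) :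
    slots (c • φ) v s = c • slots φ v s := by
  ext u w; simp [slots, mul_smul]

/-- The kernel of the insertion of `B⁻¹` on `Λᵏ V*` (all of `Λᵏ V*` for `k = 0, 1`). -/
def insertKer (B : V [⋀^Fin 2]→ₗ[ℝ] W) : (k : ℕ) → Submodule ℝ (V [⋀^Fin k]→ₗ[ℝ] ℝ)
  | 0 => ⊤
  | 1 => ⊤
  | k + 2 =>
    { carrier := {φ | ∀ (v : Fin k → V) (s : W), insertInv B φ v s = 0}
      zero_mem' := fun v s => by simp [insertInv, slots_zero]
      add_mem' := fun {φ ψ} hφ hψ v s => by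
        have h1 := hφ v s
        have h2 := hψ v s
        simp only [insertInv] at h1 h2 ⊢
        rw [slots_add, LinearMap.comp_add, map_add, h1, h2, add_zero]
      smul_mem' := fun c φ hφ v s => by
        have h1 := hφ v s
        simp only [insertInv] at h1 ⊢
        rw [slots_smul, LinearMap.comp_smul, map_smul, h1, smul_zero] }

/-- The wedge product with `B`, as a map `Λᵏ V* → Λᵏ⁺² V* ⊗ W`. -/
def wedgeTwo (B : V [⋀^Fin 2]→ₗ[ℝ] W) (k : ℕ) :
    (V [⋀^Fin k]→ₗ[ℝ] ℝ) →ₗ[ℝ] (V [⋀^Fin 2 ⊕ Fin k]→ₗ[ℝ] (W ⊗[ℝ] ℝ)) :=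
  AlternatingMap.domCoprod' ∘ₗ TensorProduct.mk ℝ _ _ B

/-- The tracefree part `Λᵏ₀ V*` of `Λᵏ V*` with respect to `B`, where `dim V = 2n`: the kernel of
the insertion of `B⁻¹` for `k ≤ n`, the kernel of the wedge product with `B` for `k > n`. -/
def primitive (n : ℕ) (B : V [⋀^Fin 2]→ₗ[ℝ] W) (k : ℕ) : Submodule ℝ (V [⋀^Fin k]→ₗ[ℝ] ℝ) :=
  if k ≤ n then insertKer B k else LinearMap.ker (wedgeTwo B k)

/-- The wedge product `a ∧ ·` with a linear form `a`, that is
`(a ∧ φ)(v₀, …, v_k) = ∑ i, (-1)ⁱ a(vᵢ) φ(v₀, …, v̂ᵢ, …, v_k)`. -/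
def wedgeOne (a : V →ₗ[ℝ] ℝ) (k : ℕ) :
    (V [⋀^Fin k]→ₗ[ℝ] ℝ) →ₗ[ℝ] (V [⋀^Fin (k + 1)]→ₗ[ℝ] ℝ) :=
  AlternatingMap.alternatizeUncurryFinLM ∘ₗ LinearMap.smulRightₗ a

theorem wedgeOne_apply (a : V →ₗ[ℝ] ℝ) (k : ℕ) (φ : V [⋀^Fin k]→ₗ[ℝ] ℝ) (v : Fin (k + 1) → V) :
    wedgeOne a k φ v = ∑ i : Fin (k + 1), (-1 : ℝ) ^ (i : ℕ) * (a (v i) * φ (i.removeNth v)) := by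
  simp [wedgeOne, AlternatingMap.alternatizeUncurryFin_apply]

/-- The pullback `φ ↦ φ(g ·, …, g ·)` along a linear map `g`. -/
def pullbackLin {V' : Type*} [AddCommGroup V'] [Module ℝ V'] (g : V' →ₗ[ℝ] V) (k : ℕ) :
    (V [⋀^Fin k]→ₗ[ℝ] ℝ) →ₗ[ℝ] (V' [⋀^Fin k]→ₗ[ℝ] ℝ) where
  toFun φ := φ.compLinearMap g
  map_add' _ _ := rfl
  map_smul' _ _ := rfl

end LinearAlgebra

/-! ### Vector fields, differential forms and Lie derivatives

All manifolds are modelled on a normed space `E`, without boundary. -/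

section Forms

variable {E : Type*} [NormedAddCommGroup E] [NormedSpace ℝ E]
  {N : Type*} [TopologicalSpace N] [ChartedSpace E N] [IsManifold 𝓘(ℝ, E) ∞ N]

/-- The vector field `X` is smooth on `U`. -/
def SmoothVF (U : Set N) (X : ∀ x : N, TangentSpace 𝓘(ℝ, E) x) : Prop :=
  ContMDiffOn 𝓘(ℝ, E) 𝓘(ℝ, E).tangent ∞ (fun x => (⟨x, X x⟩ : TangentBundle 𝓘(ℝ, E) N)) U

/-- `Ωᵏ(N)`: the `k`-forms whose values on smooth vector fields, defined on any open set, are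
smooth functions. -/
def Omega (E N : Type*) [NormedAddCommGroup E] [NormedSpace ℝ E] [TopologicalSpace N]
    [ChartedSpace E N] [IsManifold 𝓘(ℝ, E) ∞ N] (k : ℕ) :
    Submodule ℝ (∀ x : N, TangentSpace 𝓘(ℝ, E) x [⋀^Fin k]→ₗ[ℝ] ℝ) where
  carrier := {ψ | ∀ (U : Set N) (X : Fin k → ∀ x : N, TangentSpace 𝓘(ℝ, E) x), IsOpen U →
    (∀ i, SmoothVF U (X i)) → ContMDiffOn 𝓘(ℝ, E) 𝓘(ℝ, ℝ) ∞ (fun x => ψ x (fun i => X i x)) U}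
  zero_mem' := fun _ _ _ _ => contMDiffOn_const
  add_mem' := fun hφ hψ U X hU hX => (hφ U X hU hX).add (hψ U X hU hX)
  smul_mem' := fun c _ hφ U X hU hX => by
    have h : ContMDiffOn 𝓘(ℝ, E) 𝓘(ℝ, ℝ) ∞ (fun _ : N => c) U := contMDiffOn_const
    exact h.smul (hφ U X hU hX)

/-- `τ = L_ξ ψ` for `k`-forms: for all smooth vector fields `X₁, …, X_k` defined on an open set,
`τ(X₁, …, X_k) = ξ · ψ(X₁, …, X_k) - ∑ i, ψ(X₁, …, [ξ, Xᵢ], …, X_k)`. -/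
def IsLieDeriv (ξ : ∀ x : N, TangentSpace 𝓘(ℝ, E) x) {k : ℕ}
    (ψ τ : ∀ x : N, TangentSpace 𝓘(ℝ, E) x [⋀^Fin k]→ₗ[ℝ] ℝ) : Prop :=
  ∀ (U : Set N) (X : Fin k → ∀ x : N, TangentSpace 𝓘(ℝ, E) x), IsOpen U →
    (∀ i, SmoothVF U (X i)) → ∀ x ∈ U,
      τ x (fun i => X i x) =
        mvfderiv 𝓘(ℝ, E) (fun y => ψ y (fun i => X i y)) x (ξ x) -
          ∑ i, ψ x (Function.update (fun j => X j x) i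
            (VectorField.mlieBracket 𝓘(ℝ, E) ξ (X i) x))

/-- The wedge product `φ ↦ α ∧ φ` with a one-form `α`. -/
def wedge (α : ∀ x : N, TangentSpace 𝓘(ℝ, E) x →ₗ[ℝ] ℝ) (k : ℕ) :
    (∀ x : N, TangentSpace 𝓘(ℝ, E) x [⋀^Fin k]→ₗ[ℝ] ℝ) →ₗ[ℝ]
      (∀ x : N, TangentSpace 𝓘(ℝ, E) x [⋀^Fin (k + 1)]→ₗ[ℝ] ℝ) :=
  LinearMap.pi fun x => wedgeOne (α x) k ∘ₗ LinearMap.proj x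

/-- The one-form `α` is smooth. -/
def SmoothOneForm (α : ∀ x : N, TangentSpace 𝓘(ℝ, E) x →ₗ[ℝ] ℝ) : Prop :=
  ∀ (U : Set N) (X : ∀ x : N, TangentSpace 𝓘(ℝ, E) x), IsOpen U → SmoothVF U X →
    ContMDiffOn 𝓘(ℝ, E) 𝓘(ℝ, ℝ) ∞ (fun x => α x (X x)) U

/-- The pullback of `k`-forms along `q`. -/
def pullback (E' : Type*) {N' : Type*} [NormedAddCommGroup E'] [NormedSpace ℝ E']
    [TopologicalSpace N'] [ChartedSpace E' N'] (q : N → N') (k : ℕ) :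
    (∀ y : N', TangentSpace 𝓘(ℝ, E') y [⋀^Fin k]→ₗ[ℝ] ℝ) →ₗ[ℝ]
      (∀ x : N, TangentSpace 𝓘(ℝ, E) x [⋀^Fin k]→ₗ[ℝ] ℝ) :=
  LinearMap.pi fun x =>
    pullbackLin (mfderiv 𝓘(ℝ, E) 𝓘(ℝ, E') q x).toLinearMap k ∘ₗ LinearMap.proj (q x)

end Forms

/-! ### Distributions, contact structures, and forms on a distribution -/

section Contact

variable {E : Type*} [NormedAddCommGroup E] [NormedSpace ℝ E]
  {N : Type*} [TopologicalSpace N] [ChartedSpace E N] [IsManifold 𝓘(ℝ, E) ∞ N]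
  (H : ∀ x : N, Submodule ℝ (TangentSpace 𝓘(ℝ, E) x))

/-- `X` is a smooth section of `H` over `U` (its values off `U` are irrelevant). -/
def SmoothSec (U : Set N) (X : ∀ x : N, H x) : Prop :=
  SmoothVF U (fun x => (X x : TangentSpace 𝓘(ℝ, E) x))

/-- `H` is a smooth distribution of rank `r`: locally, it has a smooth frame of length `r`. -/
def IsDistribution (r : ℕ) : Prop :=
  ∀ x₀ : N, ∃ U : Set N, IsOpen U ∧ x₀ ∈ U ∧
    ∃ X : Fin r → ∀ x : N, TangentSpace 𝓘(ℝ, E) x, (∀ i, SmoothVF U (X i)) ∧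
      ∀ x ∈ U, LinearIndependent ℝ (fun i => X i x) ∧
        Submodule.span ℝ (Set.range fun i => X i x) = H x

/-- `B` is the Levi bracket `Λ²H_x → Q_x = T_xN / H_x` at `x`: it maps `(X(x), Y(x))` to the class of
`[X, Y](x)`, for all local smooth sections `X, Y` of `H`. -/
def IsLeviBracketAt (x : N) (B : H x [⋀^Fin 2]→ₗ[ℝ] (TangentSpace 𝓘(ℝ, E) x ⧸ H x)) : Prop :=
  ∀ (U : Set N) (X Y : ∀ y : N, H y), IsOpen U → x ∈ U → SmoothSec H U X → SmoothSec H U Y →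
    B ![X x, Y x] = (H x).mkQ (VectorField.mlieBracket 𝓘(ℝ, E)
      (fun y => (X y : TangentSpace 𝓘(ℝ, E) y)) (fun y => (Y y : TangentSpace 𝓘(ℝ, E) y)) x)

open Classical in
/-- The Levi bracket at `x`. For a smooth distribution of finite rank there is exactly one `B` as
in `IsLeviBracketAt`. -/
def leviBracket (x : N) : H x [⋀^Fin 2]→ₗ[ℝ] (TangentSpace 𝓘(ℝ, E) x ⧸ H x) :=
  if h : ∃ B, IsLeviBracketAt H x B then h.choose else 0

/-- `H` is a contact structure on the `(2n+1)`-dimensional manifold `N`: a distribution of rank `2n`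
whose Levi bracket is non-degenerate in each point. -/
structure IsContact (n : ℕ) : Prop where
  isDistribution : IsDistribution H (2 * n)
  nondegenerate : ∀ x, Nondegenerate (leviBracket H x)

/-- `ξ` is a transversal infinitesimal automorphism of `(N, H)`: a smooth vector field which is
nowhere in `H` and for which `[ξ, η]` is a section of `H` for every (local) smooth section `η`
of `H`. -/
structure IsTransversalAut (ξ : ∀ x : N, TangentSpace 𝓘(ℝ, E) x) : Prop where
  smooth : SmoothVF Set.univ ξ
  transversal : ∀ x, ξ x ∉ H x
  bracket_mem : ∀ (U : Set N) (η : ∀ x : N, H x), IsOpen U → SmoothSec H U η → ∀ x ∈ U,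
    VectorField.mlieBracket 𝓘(ℝ, E) ξ (fun y => (η y : TangentSpace 𝓘(ℝ, E) y)) x ∈ H x

/-- `α` is a contact form for the contact structure `H`: a smooth one-form with kernel `H`. -/
def IsContactForm (α : ∀ x : N, TangentSpace 𝓘(ℝ, E) x →ₗ[ℝ] ℝ) : Prop :=
  SmoothOneForm α ∧ ∀ x, LinearMap.ker (α x) = H x

/-- `Γ(Λᵏ H*)`: the families of alternating `k`-linear forms on the spaces `H_x` whose values on
smooth sections of `H`, defined on any open set, are smooth functions. -/
def GammaH (k : ℕ) : Submodule ℝ (∀ x : N, H x [⋀^Fin k]→ₗ[ℝ] ℝ) where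
  carrier := {σ | ∀ (U : Set N) (X : Fin k → ∀ x : N, H x), IsOpen U →
    (∀ i, SmoothSec H U (X i)) → ContMDiffOn 𝓘(ℝ, E) 𝓘(ℝ, ℝ) ∞ (fun x => σ x (fun i => X i x)) U}
  zero_mem' := fun _ _ _ _ => contMDiffOn_const
  add_mem' := fun hφ hψ U X hU hX => (hφ U X hU hX).add (hψ U X hU hX)
  smul_mem' := fun c _ hφ U X hU hX => by
    have h : ContMDiffOn 𝓘(ℝ, E) 𝓘(ℝ, ℝ) ∞ (fun _ : N => c) U := contMDiffOn_const
    exact h.smul (hφ U X hU hX)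

/-- `Γ(Λᵏ₀ H*)`. -/
def GammaH0 (n k : ℕ) : Submodule ℝ (∀ x : N, H x [⋀^Fin k]→ₗ[ℝ] ℝ) :=
  GammaH H k ⊓ Submodule.pi Set.univ fun x => primitive n (leviBracket H x) k

/-- The restriction of `k`-forms on `N` to multilinear forms on `H`. -/
def restrict (k : ℕ) :
    (∀ x : N, TangentSpace 𝓘(ℝ, E) x [⋀^Fin k]→ₗ[ℝ] ℝ) →ₗ[ℝ] (∀ x : N, H x [⋀^Fin k]→ₗ[ℝ] ℝ) :=
  LinearMap.pi fun x => pullbackLin (H x).subtype k ∘ₗ LinearMap.proj x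

/-- `Γ(Λᵏ H* ⊗ Q*)`, where `Λᵏ H* ⊗ Q*` is viewed as the kernel of the restriction map
`Λᵏ⁺¹ T*N → Λᵏ⁺¹ H*`: the `(k+1)`-forms which vanish if all their entries are from `H`. Here a
form `ψ` in this kernel corresponds to the element of `Λᵏ H* ⊗ Q*` that maps
`h₁, …, h_k ∈ H_x` and the class in `Q_x` of `u ∈ T_xN` to `ψ(u, h₁, …, h_k)`. -/
def GammaHQ (k : ℕ) : Submodule ℝ (∀ x : N, TangentSpace 𝓘(ℝ, E) x [⋀^Fin (k + 1)]→ₗ[ℝ] ℝ) :=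
  Omega E N (k + 1) ⊓ LinearMap.ker (restrict H (k + 1))

/-- `Γ(Λᵏ₀ H* ⊗ Q*)`: those `ψ ∈ Γ(Λᵏ H* ⊗ Q*)` for which the `k`-form
`(h₁, …, h_k) ↦ ψ(u, h₁, …, h_k)` on `H_x` lies in `Λᵏ₀ H_x*` for all `u ∈ T_xN`. -/
def GammaHQ0 (n k : ℕ) :
    Submodule ℝ (∀ x : N, TangentSpace 𝓘(ℝ, E) x [⋀^Fin (k + 1)]→ₗ[ℝ] ℝ) where
  carrier := {ψ | ψ ∈ GammaHQ H k ∧ ∀ (x : N) (u : TangentSpace 𝓘(ℝ, E) x),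
    ((ψ x).curryLeft u).compLinearMap (H x).subtype ∈ primitive n (leviBracket H x) k}
  zero_mem' := ⟨zero_mem _, fun x _ => zero_mem (primitive n (leviBracket H x) k)⟩
  add_mem' := fun hφ hψ => ⟨add_mem hφ.1 hψ.1, fun x u =>
    add_mem (S := Submodule ℝ (H x [⋀^Fin k]→ₗ[ℝ] ℝ)) (hφ.2 x u) (hψ.2 x u)⟩
  smul_mem' := fun c _ hφ => ⟨Submodule.smul_mem _ c hφ.1, fun x u =>
    Submodule.smul_mem (primitive n (leviBracket H x) k) c (hφ.2 x u)⟩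

/-- `τ = L_ξ σ` for sections of `Λᵏ H*`: for all smooth sections `X₁, …, X_k` of `H` defined on an
open set, `τ(X₁, …, X_k) = ξ · σ(X₁, …, X_k) - ∑ i, σ(X₁, …, [ξ, Xᵢ], …, X_k)`. Here `Z i` is
the value `[ξ, Xᵢ](x)`, which lies in `H_x` for an infinitesimal automorphism `ξ`. -/
def IsLieDerivH (ξ : ∀ x : N, TangentSpace 𝓘(ℝ, E) x) {k : ℕ}
    (σ τ : ∀ x : N, H x [⋀^Fin k]→ₗ[ℝ] ℝ) : Prop :=
  ∀ (U : Set N) (X : Fin k → ∀ x : N, H x), IsOpen U → (∀ i, SmoothSec H U (X i)) → ∀ x ∈ U,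
    ∀ Z : Fin k → H x, (∀ i, (Z i : TangentSpace 𝓘(ℝ, E) x) = VectorField.mlieBracket 𝓘(ℝ, E) ξ
        (fun y => (X i y : TangentSpace 𝓘(ℝ, E) y)) x) →
      τ x (fun i => X i x) =
        mvfderiv 𝓘(ℝ, E) (fun y => σ y (fun i => X i y)) x (ξ x) -
          ∑ i, σ x (Function.update (fun j => X j x) i (Z i))

end Contact

/-! ### Quotients and the induced conformally symplectic structure -/

section Quotient

variable {E : Type*} [NormedAddCommGroup E] [NormedSpace ℝ E]
  {N : Type*} [TopologicalSpace N] [ChartedSpace E N] [IsManifold 𝓘(ℝ, E) ∞ N]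
  (E' : Type*) [NormedAddCommGroup E'] [NormedSpace ℝ E']
  {N' : Type*} [TopologicalSpace N'] [ChartedSpace E' N'] [IsManifold 𝓘(ℝ, E') ∞ N']

/-- `q : N → N'` is a quotient by the vector field `ξ`: a surjective submersion with connected
fibers whose vertical spaces are spanned by `ξ`. -/
structure IsQuotient (ξ : ∀ x : N, TangentSpace 𝓘(ℝ, E) x) (q : N → N') : Prop where
  submersion : Manifold.IsSubmersion 𝓘(ℝ, E) 𝓘(ℝ, E') ∞ q
  surjective : Function.Surjective q
  ker_eq : ∀ x, LinearMap.ker (mfderiv 𝓘(ℝ, E) 𝓘(ℝ, E') q x).toLinearMap = Submodule.span ℝ {ξ x}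
  connected : ∀ y, IsConnected (q ⁻¹' {y})

variable (H : ∀ x : N, Submodule ℝ (TangentSpace 𝓘(ℝ, E) x)) (q : N → N')

/-- The fiber at `y` of the line bundle `ℓ ⊂ Λ²T*N'` determined by the Levi bracket: the two-forms
on `T_yN'` which, for `x` over `y`, become under `T_xq : H_x → T_yN'` the composition of the Levi
bracket with some linear form on the line `Q_x`. -/
def csLine (y : N') : Submodule ℝ (TangentSpace 𝓘(ℝ, E') y [⋀^Fin 2]→ₗ[ℝ] ℝ) where
  carrier := {θ | ∀ (x : N) (hx : q x = y),
    ∃ c : (TangentSpace 𝓘(ℝ, E) x ⧸ H x) →ₗ[ℝ] ℝ, ∀ u v : H x,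
      θ ![hx ▸ mfderiv 𝓘(ℝ, E) 𝓘(ℝ, E') q x u, hx ▸ mfderiv 𝓘(ℝ, E) 𝓘(ℝ, E') q x v] =
        c (leviBracket H x ![u, v])}
  zero_mem' := fun x hx => ⟨0, fun u v => by simp⟩
  add_mem' := fun hθ hθ' x hx => by
    obtain ⟨c, hc⟩ := hθ x hx
    obtain ⟨c', hc'⟩ := hθ' x hx
    exact ⟨c + c', fun u v => by simp [hc u v, hc' u v]⟩
  smul_mem' := fun a θ hθ x hx => by
    obtain ⟨c, hc⟩ := hθ x hx
    exact ⟨a • c, fun u v => by simp [hc u v]⟩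

/-- The inclusion `ℓ → Λ²T*N'`, viewed as a two-form with values in `ℓ*`. -/
def csForm (y : N') :
    TangentSpace 𝓘(ℝ, E') y [⋀^Fin 2]→ₗ[ℝ] (csLine E' H q y →ₗ[ℝ] ℝ) where
  toFun v :=
    { toFun := fun θ => θ.1 v
      map_add' := fun _ _ => rfl
      map_smul' := fun _ _ => rfl }
  map_update_add' v i a b := by ext θ; simp
  map_update_smul' v i c a := by ext θ; simp
  map_eq_zero_of_eq' v i j h hij := by ext θ; simpa using θ.1.map_eq_zero_of_eq v h hij

/-- `Ωᵏ₀(N')`: the smooth sections of `Λᵏ₀ T*N'`. -/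
def Omega0 (n k : ℕ) : Submodule ℝ (∀ y : N', TangentSpace 𝓘(ℝ, E') y [⋀^Fin k]→ₗ[ℝ] ℝ) :=
  Omega E' N' k ⊓ Submodule.pi Set.univ fun y => primitive n (csForm E' H q y) k

end Quotient

end ContactQuotient

end

/-! The tangent bundle of `N` splits as `H ⊕ ℝξ`, and since `ℝξ` is the kernel of `T_x q`, this
derivative restricts to an isomorphism from `H_x` to the tangent space of `M` at `q x`. The form `α`
is the projection onto `ℝξ` along `H`; being a contact form with value 1 on `ξ` leaves no other
choice.

Flows are not needed. The central fact is `mlieBracket_hlift`: the horizontal lift of a vector field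
on `M` commutes with `ξ`. The bracket lies in `H` because `ξ` is an infinitesimal automorphism, and
it is vertical because `ξ` and the lift are `q`-related to `0` and to the given field. Hence, for an
invariant section `σ` of `Λᵏ H*`, the function obtained by inserting horizontal lifts is annihilated
by `ξ`. In submersion charts such a function is locally constant on the fibers, so it is constant on
them as they are connected. Therefore `σ` comes from a form on `M`, whose smoothness is seen through
local sections of `q` (`exists_descent`).

Conversely, pullbacks are invariant (`isLieDeriv_pullback`), and so is `α ∧ ψ` for invariant `ψ`,
since `L_ξ α = 0` (`mvfderiv_form`, `isLieDeriv_wedge`). A form on `N` is determined by its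
restriction to `H` and by its contraction with `ξ`, also restricted to `H` (`ext_of_restrict`). For
an invariant form both pieces are invariant and descend separately; this yields the decomposition of
invariant forms and the description of sections of `Λᵏ H* ⊗ Q*`.

For the tracefree parts, `α ∘ 𝓛` is invariant by the Jacobi identity, so it descends to a two-form
on `M`, which spans the line `ℓ` when `n ≥ 1`. Thus `T_x q` carries the Levi bracket to `𝛀` up to an
isomorphism of the value lines (`exists_csForm_equiv`). The tracefree condition is natural under
such isomorphisms (`mem_primitive_iff`) and pointwise, so the refined bijections follow from the
unrefined ones. -/

noncomputable section

namespace ContactQuotient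

/-! ### Smooth coefficients, local frames and extensions of tangent vectors -/

section Calculus

variable {E : Type*} [NormedAddCommGroup E] [NormedSpace ℝ E]
  {N : Type*} [TopologicalSpace N] [ChartedSpace E N]
  {E' : Type*} [NormedAddCommGroup E'] [NormedSpace ℝ E']
  {M : Type*} [TopologicalSpace M] [ChartedSpace E' M]
  {F : Type*} [NormedAddCommGroup F] [NormedSpace ℝ F]

/-- Coefficients with respect to a smooth pointwise basis of a vector space are smooth. -/
theorem contMDiffAt_coeff_of_basis {ι : Type*} [Fintype ι] [FiniteDimensional ℝ F]
    (hι : Fintype.card ι = Module.finrank ℝ F) {e : ι → N → F} {x₀ : N}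
    (he : ∀ i, ContMDiffAt 𝓘(ℝ, E) 𝓘(ℝ, F) ∞ (e i) x₀)
    (hli : LinearIndependent ℝ (fun i => e i x₀)) {v : N → F}
    (hv : ContMDiffAt 𝓘(ℝ, E) 𝓘(ℝ, F) ∞ v x₀) {c : N → ι → ℝ}
    (hc : ∀ᶠ x in 𝓝 x₀, ∑ i, c x i • e i x = v x) :
    ContMDiffAt 𝓘(ℝ, E) 𝓘(ℝ, ι → ℝ) ∞ c x₀ := by
  classical
  -- Near `x₀` the coefficients are `(L x)⁻¹ (v x)`. Invertible operators form an open set on which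
  -- inversion is smooth.
  let L : N → (ι → ℝ) →L[ℝ] F := fun x =>
    ∑ i, ContinuousLinearMap.smulRightL ℝ (ι → ℝ) F (ContinuousLinearMap.proj i) (e i x)
  have hL : ∀ x a, L x a = ∑ i, a i • e i x := fun x a => by simp [L]
  have hLs : ContMDiffAt 𝓘(ℝ, E) 𝓘(ℝ, (ι → ℝ) →L[ℝ] F) ∞ L x₀ := by
    refine ContMDiffAt.sum fun i _ => ?_
    exact ContMDiffAt.clm_apply contMDiffAt_const (he i)
  have hinj : Function.Injective (L x₀) := by
    rw [injective_iff_map_eq_zero]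
    intro a ha
    rw [hL] at ha
    exact funext fun i => Fintype.linearIndependent_iff.1 hli a ha i
  let T : (ι → ℝ) ≃L[ℝ] F := (LinearEquiv.ofInjectiveOfFinrankEq (L x₀ : (ι → ℝ) →ₗ[ℝ] F) hinj
    (by simp [hι])).toContinuousLinearEquiv
  have hT : (T : (ι → ℝ) →L[ℝ] F) = L x₀ := by ext; rfl
  have hinv : ∀ᶠ x in 𝓝 x₀, (L x).IsInvertible := by
    have h1 : Set.range ((↑) : ((ι → ℝ) ≃L[ℝ] F) → ((ι → ℝ) →L[ℝ] F)) ∈ 𝓝 (L x₀) :=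
      ContinuousLinearEquiv.isOpen.mem_nhds ⟨T, hT⟩
    exact hLs.continuousAt h1
  have h2 : ContMDiffAt 𝓘(ℝ, E) 𝓘(ℝ, F →L[ℝ] (ι → ℝ)) ∞ (fun x => (L x).inverse) x₀ :=
    ContDiffAt.comp_contMDiffAt (g := ContinuousLinearMap.inverse) (f := L) (x := x₀)
      (ContinuousLinearMap.IsInvertible.contDiffAt_map_inverse ⟨T, hT⟩) hLs
  refine (h2.clm_apply hv).congr_of_eventuallyEq ?_
  filter_upwards [hc, hinv] with x hx hx'
  rw [← hx, ← hL]
  obtain ⟨S, hS⟩ := hx'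
  rw [← hS]
  simp

variable [IsManifold 𝓘(ℝ, E') ∞ M]

/-- Coefficients with respect to a smooth pointwise basis of the tangent spaces along a map are
smooth. -/
theorem contMDiffAt_coeff_along {ι : Type*} [Fintype ι] [FiniteDimensional ℝ E']
    (hι : Fintype.card ι = Module.finrank ℝ E') {f : N → M} {x₀ : N}
    {e : ι → ∀ x : N, TangentSpace 𝓘(ℝ, E') (f x)}
    (he : ∀ i, ContMDiffAt 𝓘(ℝ, E) 𝓘(ℝ, E').tangent ∞
      (fun x => (⟨f x, e i x⟩ : TangentBundle 𝓘(ℝ, E') M)) x₀)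
    (hli : LinearIndependent ℝ (fun i => e i x₀)) {v : ∀ x : N, TangentSpace 𝓘(ℝ, E') (f x)}
    (hv : ContMDiffAt 𝓘(ℝ, E) 𝓘(ℝ, E').tangent ∞
      (fun x => (⟨f x, v x⟩ : TangentBundle 𝓘(ℝ, E') M)) x₀) {c : N → ι → ℝ}
    (hc : ∀ᶠ x in 𝓝 x₀, ∑ i, c x i • e i x = v x) :
    ContMDiffAt 𝓘(ℝ, E) 𝓘(ℝ, ι → ℝ) ∞ c x₀ := by
  set τ := trivializationAt E' (TangentSpace 𝓘(ℝ, E') : M → Type _) (f x₀) with hτ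
  obtain ⟨hf, hv'⟩ := Bundle.contMDiffAt_totalSpace.1 hv
  have he' := fun i => (Bundle.contMDiffAt_totalSpace.1 (he i)).2
  have hmem : ∀ᶠ x in 𝓝 x₀, f x ∈ τ.baseSet :=
    hf.continuousAt (τ.open_baseSet.mem_nhds (FiberBundle.mem_baseSet_trivializationAt' (f x₀)))
  refine contMDiffAt_coeff_of_basis (F := E') hι (e := fun i x => (τ ⟨f x, e i x⟩).2) he' ?_
    (v := fun x => (τ ⟨f x, v x⟩).2) hv' ?_
  · have := hmem.self_of_nhds
    have h := hli.map' (τ.continuousLinearEquivAt ℝ (f x₀) this).toLinearEquiv.toLinearMap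
      (LinearEquiv.ker _)
    exact h
  · filter_upwards [hc, hmem] with x hx hx'
    have h : ∀ w : TangentSpace 𝓘(ℝ, E') (f x), (τ ⟨f x, w⟩).2 = τ.continuousLinearEquivAt ℝ (f x) hx' w :=
      fun w => rfl
    simp only [h]
    rw [← hx, map_sum]
    simp

theorem SmoothVF.comp {V : Set M} {Y : ∀ y : M, TangentSpace 𝓘(ℝ, E') y} (hY : SmoothVF V Y)
    (hV : IsOpen V) {f : N → M} {x₀ : N} (hf : ContMDiffAt 𝓘(ℝ, E) 𝓘(ℝ, E') ∞ f x₀)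
    (hx : f x₀ ∈ V) : ContMDiffAt 𝓘(ℝ, E) 𝓘(ℝ, E').tangent ∞
      (fun x => (⟨f x, Y (f x)⟩ : TangentBundle 𝓘(ℝ, E') M)) x₀ :=
  (ContMDiffOn.contMDiffAt hY (hV.mem_nhds hx)).comp x₀ hf

variable [IsManifold 𝓘(ℝ, E) ∞ N]

theorem SmoothVF.contMDiffAt {U : Set N} {X : ∀ x : N, TangentSpace 𝓘(ℝ, E) x} (hX : SmoothVF U X)
    (hU : IsOpen U) {x : N} (hx : x ∈ U) : ContMDiffAt 𝓘(ℝ, E) 𝓘(ℝ, E).tangent ∞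
      (fun x => (⟨x, X x⟩ : TangentBundle 𝓘(ℝ, E) N)) x :=
  ContMDiffOn.contMDiffAt hX (hU.mem_nhds hx)

theorem SmoothVF.mdifferentiableAt {U : Set N} {X : ∀ x : N, TangentSpace 𝓘(ℝ, E) x}
    (hX : SmoothVF U X) (hU : IsOpen U) {x : N} (hx : x ∈ U) :
    MDifferentiableAt 𝓘(ℝ, E) 𝓘(ℝ, E).tangent
      (fun x => (⟨x, X x⟩ : TangentBundle 𝓘(ℝ, E) N)) x :=
  (hX.contMDiffAt hU hx).mdifferentiableAt (by simp)

/-- The image of a smooth vector field under the derivative of a map is smooth. -/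
theorem contMDiffAt_mfderiv_apply {f : N → M} (hf : ContMDiff 𝓘(ℝ, E) 𝓘(ℝ, E') ∞ f)
    {X : ∀ x : N, TangentSpace 𝓘(ℝ, E) x} {x₀ : N}
    (hX : ContMDiffAt 𝓘(ℝ, E) 𝓘(ℝ, E).tangent ∞
      (fun x => (⟨x, X x⟩ : TangentBundle 𝓘(ℝ, E) N)) x₀) :
    ContMDiffAt 𝓘(ℝ, E) 𝓘(ℝ, E').tangent ∞
      (fun x => (⟨f x, mfderiv 𝓘(ℝ, E) 𝓘(ℝ, E') f x (X x)⟩ : TangentBundle 𝓘(ℝ, E') M)) x₀ :=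
  ((hf.contMDiff_tangentMap (m := ∞) le_rfl).contMDiffAt (x := ⟨x₀, X x₀⟩)).comp x₀ hX

/-- Tangent vectors at a point extend to smooth vector fields around it. -/
theorem exists_smoothVF_extend {ι : Type*} (y : N) (u : ι → TangentSpace 𝓘(ℝ, E) y) :
    ∃ (V : Set N) (Y : ι → ∀ x : N, TangentSpace 𝓘(ℝ, E) x), IsOpen V ∧ y ∈ V ∧
      (∀ i, SmoothVF V (Y i)) ∧ ∀ i, Y i y = u i := by
  set τ := trivializationAt E (TangentSpace 𝓘(ℝ, E) : N → Type _) y with hτ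
  have hy : y ∈ τ.baseSet := FiberBundle.mem_baseSet_trivializationAt' y
  refine ⟨τ.baseSet, fun i x => τ.symm x (τ ⟨y, u i⟩).2, τ.open_baseSet, hy, fun i => ?_,
    fun i => τ.symm_apply_apply_mk hy (u i)⟩
  unfold SmoothVF
  rw [τ.contMDiffOn_section_baseSet_iff]
  refine contMDiffOn_const (c := (τ ⟨y, u i⟩).2) |>.congr fun x hx => ?_
  rw [τ.apply_mk_symm hx]

/-- Around each point there is a smooth frame of the tangent bundle. -/
theorem exists_local_frame [FiniteDimensional ℝ E] (y : N) :
    ∃ (V : Set N) (Y : Fin (Module.finrank ℝ E) → ∀ x : N, TangentSpace 𝓘(ℝ, E) x),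
      IsOpen V ∧ y ∈ V ∧ (∀ i, SmoothVF V (Y i)) ∧
        ∀ x ∈ V, LinearIndependent ℝ fun i => Y i x := by
  set τ := trivializationAt E (TangentSpace 𝓘(ℝ, E) : N → Type _) y with hτ
  have hy : y ∈ τ.baseSet := FiberBundle.mem_baseSet_trivializationAt' y
  have h := τ.isLocalFrameOn_localFrame_baseSet 𝓘(ℝ, E) ∞ (Module.finBasis ℝ E)
  exact ⟨τ.baseSet, _, τ.open_baseSet, hy, h.contMDiffOn, fun x hx => h.linearIndependent hx⟩

end Calculus

/-! ### The Lie bracket as a commutator of derivations -/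

section Bracket

variable {E : Type*} [NormedAddCommGroup E] [NormedSpace ℝ E]
  {N : Type*} [TopologicalSpace N] [ChartedSpace E N]
  {E' : Type*} [NormedAddCommGroup E'] [NormedSpace ℝ E']
  {M : Type*} [TopologicalSpace M] [ChartedSpace E' M]
  {F : Type*} [NormedAddCommGroup F] [NormedSpace ℝ F]

/-- The second derivative of `g` enters both iterated derivatives and cancels by symmetry; what
remains is `dg` applied to the bracket. -/
theorem fderiv_apply_lieBracket {g : E → F} {V W : E → E} {z : E} (hg : ContDiffAt ℝ 2 g z)
    (hV : DifferentiableAt ℝ V z) (hW : DifferentiableAt ℝ W z) :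
    fderiv ℝ g z (VectorField.lieBracket ℝ V W z) =
      fderiv ℝ (fun y => fderiv ℝ g y (W y)) z (V z) -
        fderiv ℝ (fun y => fderiv ℝ g y (V y)) z (W z) := by
  have hd : DifferentiableAt ℝ (fderiv ℝ g) z :=
    (hg.fderiv_right (m := 1) (by norm_num)).differentiableAt (by norm_num)
  have hs : IsSymmSndFDerivAt ℝ g z := hg.isSymmSndFDerivAt (by simp)
  rw [fderiv_clm_apply hd hW, fderiv_clm_apply hd hV]
  simp [VectorField.lieBracket, hs (V z) (W z)]

variable [IsManifold 𝓘(ℝ, E) ∞ N]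

/-- Read in the chart at `x₀`, this is the identity on a vector space. Vector-valued `g` are allowed
because it will be applied to a chart of `M` composed with `q`. -/
theorem mvfderiv_apply_mlieBracket [CompleteSpace E] {g : N → F} {V W : ∀ x : N, TangentSpace 𝓘(ℝ, E) x} {x₀ : N}
    (hg : ContMDiffAt 𝓘(ℝ, E) 𝓘(ℝ, F) ∞ g x₀)
    (hV : MDifferentiableAt 𝓘(ℝ, E) 𝓘(ℝ, E).tangent
      (fun x => (⟨x, V x⟩ : TangentBundle 𝓘(ℝ, E) N)) x₀)
    (hW : MDifferentiableAt 𝓘(ℝ, E) 𝓘(ℝ, E).tangent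
      (fun x => (⟨x, W x⟩ : TangentBundle 𝓘(ℝ, E) N)) x₀) :
    mvfderiv 𝓘(ℝ, E) g x₀ (VectorField.mlieBracket 𝓘(ℝ, E) V W x₀) =
      mvfderiv 𝓘(ℝ, E) (fun x => mvfderiv 𝓘(ℝ, E) g x (W x)) x₀ (V x₀) -
        mvfderiv 𝓘(ℝ, E) (fun x => mvfderiv 𝓘(ℝ, E) g x (V x)) x₀ (W x₀) := by
  set φ := extChartAt 𝓘(ℝ, E) x₀ with hφ
  set z := φ x₀ with hz
  have hzt : z ∈ φ.target := mem_extChartAt_target x₀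
  have hsymm : φ.symm z = x₀ := extChartAt_to_inv x₀
  set g' : E → F := g ∘ φ.symm with hg'
  have hsm : ∀ w ∈ φ.target, ContMDiffAt 𝓘(ℝ, E) 𝓘(ℝ, E) ∞ φ.symm w := fun w hw =>
    (contMDiffOn_extChartAt_symm x₀).contMDiffAt ((isOpen_extChartAt_target x₀).mem_nhds hw)
  have hg's : ContDiffAt ℝ ∞ g' z := by
    rw [← contMDiffAt_iff_contDiffAt]
    exact ContMDiffAt.comp z (by rwa [hsymm]) (hsm z hzt)
  have hgev : ∀ᶠ x in 𝓝 x₀, ContMDiffAt 𝓘(ℝ, E) 𝓘(ℝ, F) 1 g x :=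
    (contMDiffAt_iff_contMDiffAt_nhds (by simp)).1 (hg.of_le (by simp))
  -- the derivative of the inverse chart and the pulled back fields
  let D : E → E →L[ℝ] E := fun w => mfderivWithin 𝓘(ℝ, E) 𝓘(ℝ, E) φ.symm (Set.range 𝓘(ℝ, E)) w
  let G : N → E →L[ℝ] F := fun x => mfderiv 𝓘(ℝ, E) 𝓘(ℝ, F) g x
  -- Tangent vectors at `x₀` are written in this very chart, so fields and their pullbacks agree at
  -- the base point.
  have hDz : D z = ContinuousLinearMap.id ℝ E := mfderivWithin_range_extChartAt_symm
  have hD : ∀ w, D w = mfderiv 𝓘(ℝ, E) 𝓘(ℝ, E) φ.symm w := by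
    intro w
    have h : Set.range 𝓘(ℝ, E) = Set.univ := Set.range_eq_univ.2 fun x => ⟨x, rfl⟩
    have := mfderivWithin_univ (I := 𝓘(ℝ, E)) (I' := 𝓘(ℝ, E)) (f := φ.symm)
    rw [← h] at this
    exact congrFun this w
  have hDinv : ∀ w ∈ φ.target, ∀ v, D w ((D w).inverse v) = v := by
    intro w hw v
    have h : (D w).IsInvertible := isInvertible_mfderivWithin_extChartAt_symm hw
    obtain ⟨T, hT⟩ := h
    rw [← hT]
    simp
  let P : (∀ x : N, TangentSpace 𝓘(ℝ, E) x) → E → E := fun X =>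
    VectorField.mpullbackWithin 𝓘(ℝ, E) 𝓘(ℝ, E) φ.symm X (Set.range 𝓘(ℝ, E))
  have hP : ∀ X w, P X w = (D w).inverse (X (φ.symm w)) := fun X w => rfl
  have hPz : ∀ X, P X z = X x₀ := by
    intro X
    rw [hP, hDz, ContinuousLinearMap.inverse_id, hsymm]
    rfl
  have hPd : ∀ X : ∀ x : N, TangentSpace 𝓘(ℝ, E) x, MDifferentiableAt 𝓘(ℝ, E) 𝓘(ℝ, E).tangent
      (fun x => (⟨x, X x⟩ : TangentBundle 𝓘(ℝ, E) N)) x₀ → DifferentiableAt ℝ (P X) z := by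
    intro X hX
    have h := MDifferentiableWithinAt.differentiableWithinAt_mpullbackWithin_vectorField
      hX.mdifferentiableWithinAt (s := Set.univ)
    have hr : φ.symm ⁻¹' Set.univ ∩ Set.range 𝓘(ℝ, E) = Set.univ := by
      ext x; exact ⟨fun _ => trivial, fun _ => ⟨trivial, x, rfl⟩⟩
    rw [hr] at h
    exact differentiableWithinAt_univ.1 h
  have hcomp : ∀ w ∈ φ.target, MDifferentiableAt 𝓘(ℝ, E) 𝓘(ℝ, F) g (φ.symm w) → ∀ v : E,
      fderiv ℝ g' w v = G (φ.symm w) (D w v) := by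
    intro w hw hgw v
    rw [hD, ← mfderiv_eq_fderiv]
    exact mfderiv_comp_apply w hgw ((hsm _ hw).mdifferentiableAt (by simp)) v
  have hgP : ∀ X, ∀ᶠ x in 𝓝 x₀, mvfderiv 𝓘(ℝ, E) g x (X x) = fderiv ℝ g' (φ x) (P X (φ x)) := by
    intro X
    filter_upwards [hgev, extChartAt_source_mem_nhds (I := 𝓘(ℝ, E)) x₀] with x hx hxs
    have hxt : φ x ∈ φ.target := φ.map_source hxs
    have hxx : φ.symm (φ x) = x := φ.left_inv hxs
    let X' : N → E := X
    have hX' : P X (φ x) = (D (φ x)).inverse (X' (φ.symm (φ x))) := rfl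
    rw [hX', hcomp _ hxt (by rw [hxx]; exact hx.mdifferentiableAt (by simp)), hDinv _ hxt, hxx]
    rfl
  have hg'2 : ContDiffAt ℝ 2 g' z := hg's.of_le (WithTop.coe_le_coe.2 le_top)
  have hchain : ∀ X Y : ∀ x : N, TangentSpace 𝓘(ℝ, E) x, DifferentiableAt ℝ (P X) z →
      mvfderiv 𝓘(ℝ, E) (fun x => mvfderiv 𝓘(ℝ, E) g x (X x)) x₀ (Y x₀) =
        fderiv ℝ (fun w => fderiv ℝ g' w (P X w)) z (P Y z) := by
    intro X Y hX
    have hd : DifferentiableAt ℝ (fun w => fderiv ℝ g' w (P X w)) z :=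
      ((hg'2.fderiv_right (m := 1) (by norm_num)).differentiableAt (by norm_num)).clm_apply hX
    have h1 : mfderiv 𝓘(ℝ, E) 𝓘(ℝ, F) (fun x => mvfderiv 𝓘(ℝ, E) g x (X x)) x₀ =
        mfderiv 𝓘(ℝ, E) 𝓘(ℝ, F) ((fun w => fderiv ℝ g' w (P X w)) ∘ φ) x₀ :=
      Filter.EventuallyEq.mfderiv_eq (hgP X)
    have h2 : mfderiv 𝓘(ℝ, E) 𝓘(ℝ, F) ((fun w => fderiv ℝ g' w (P X w)) ∘ φ) x₀ (Y x₀) =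
        mfderiv 𝓘(ℝ, E) 𝓘(ℝ, F) (fun w => fderiv ℝ g' w (P X w)) z
          (mfderiv 𝓘(ℝ, E) 𝓘(ℝ, E) φ x₀ (Y x₀)) :=
      mfderiv_comp_apply x₀ hd.mdifferentiableAt
        (mdifferentiableAt_extChartAt (mem_chart_source E x₀)) _
    rw [mfderiv_extChartAt_self, mfderiv_eq_fderiv] at h2
    rw [hPz]
    exact (DFunLike.congr_fun h1 (Y x₀)).trans h2
  have hbr : VectorField.mlieBracket 𝓘(ℝ, E) V W x₀ = VectorField.lieBracket ℝ (P V) (P W) z := by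
    rw [← VectorField.mlieBracketWithin_univ, VectorField.mlieBracketWithin_apply]
    have hr : φ.symm ⁻¹' Set.univ ∩ Set.range 𝓘(ℝ, E) = Set.univ := by
      ext x; exact ⟨fun _ => trivial, fun _ => ⟨trivial, x, rfl⟩⟩
    rw [hr]
    let Φ : E →L[ℝ] E := mfderiv 𝓘(ℝ, E) 𝓘(ℝ, E) φ x₀
    have hΦ : Φ = ContinuousLinearMap.id ℝ E := mfderiv_extChartAt_self
    have h : Φ.inverse = ContinuousLinearMap.id ℝ E := by rw [hΦ, ContinuousLinearMap.inverse_id]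
    refine (DFunLike.congr_fun h _).trans ?_
    exact congrFun (VectorField.lieBracketWithin_univ (𝕜 := ℝ) (V := P V) (W := P W)) z
  rw [hchain W V (hPd W hW), hchain V W (hPd V hV), ← fderiv_apply_lieBracket
    hg'2 (hPd V hV) (hPd W hW), hcomp z hzt (by rw [hsymm]; exact hg.mdifferentiableAt (by simp)),
    hsymm, hDz, hbr]
  rfl

end Bracket

/-! ### Local sections of submersions and functions constant on fibers -/

section Submersion

variable {E : Type*} [NormedAddCommGroup E] [NormedSpace ℝ E]
  {N : Type*} [TopologicalSpace N] [ChartedSpace E N]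
  {E' : Type*} [NormedAddCommGroup E'] [NormedSpace ℝ E']
  {M : Type*} [TopologicalSpace M] [ChartedSpace E' M]

/-- A submersion looks like a linear projection in suitable charts. -/
theorem exists_submersion_charts {q : N → M} (hq : Manifold.IsSubmersion 𝓘(ℝ, E) 𝓘(ℝ, E') ∞ q)
    (x₀ : N) : ∃ (φ : OpenPartialHomeomorph N E) (ψ : OpenPartialHomeomorph M E') (L : E →L[ℝ] E')
      (R : E' →L[ℝ] E),
      φ ∈ IsManifold.maximalAtlas 𝓘(ℝ, E) ∞ N ∧ ψ ∈ IsManifold.maximalAtlas 𝓘(ℝ, E') ∞ M ∧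
      x₀ ∈ φ.source ∧ (∀ x ∈ φ.source, q x ∈ ψ.source ∧ ψ (q x) = L (φ x)) ∧
      ∀ u, L (R u) = u := by
  have h := hq.isSubmersionAt x₀
  refine ⟨h.domChart, h.codChart, (ContinuousLinearMap.fst ℝ E' h.complement).comp
    (h.equiv : E →L[ℝ] E' × h.complement), (h.equiv.symm : _ →L[ℝ] E).comp
    (ContinuousLinearMap.inl ℝ E' h.complement), h.domChart_mem_maximalAtlas,
    h.codChart_mem_maximalAtlas, h.mem_domChart_source, fun x hx => ?_, fun u => ?_⟩
  · refine ⟨h.source_subset_preimage_source hx, ?_⟩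
    have h1 : (h.domChart.extend 𝓘(ℝ, E)) x ∈ (h.domChart.extend 𝓘(ℝ, E)).target :=
      (h.domChart.extend 𝓘(ℝ, E)).map_source (by rwa [OpenPartialHomeomorph.extend_source])
    have h2 := h.writtenInCharts h1
    simp only [Function.comp_apply] at h2
    rw [OpenPartialHomeomorph.extend_left_inv _ hx] at h2
    exact h2
  · simp

/-- Through each point there is a smooth local section of a submersion. -/
theorem exists_local_section {q : N → M} (hq : Manifold.IsSubmersion 𝓘(ℝ, E) 𝓘(ℝ, E') ∞ q)
    (x₀ : N) : ∃ (V : Set M) (s : M → N), IsOpen V ∧ q x₀ ∈ V ∧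
      ContMDiffOn 𝓘(ℝ, E') 𝓘(ℝ, E) ∞ s V ∧ s (q x₀) = x₀ ∧ ∀ y ∈ V, q (s y) = y := by
  obtain ⟨φ, ψ, L, R, hφ, hψ, hx₀, hc, hR⟩ := exists_submersion_charts hq x₀
  -- An affine right inverse, through `φ x₀`, of the linear chart expression `L` of `q`.
  let a : M → E := fun y => φ x₀ + R (ψ y - ψ (q x₀))
  have ha : ContMDiffOn 𝓘(ℝ, E') 𝓘(ℝ, E) ∞ a ψ.source := by
    have h1 := contMDiffOn_of_mem_maximalAtlas hψ
    have h2 : ContDiff ℝ ∞ fun z : E' => φ x₀ + R (z - ψ (q x₀)) := by fun_prop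
    exact h2.contMDiff.comp_contMDiffOn h1
  have hφs := contMDiffOn_symm_of_mem_maximalAtlas hφ
  refine ⟨ψ.source ∩ a ⁻¹' φ.target, φ.symm ∘ a,
    ha.continuousOn.isOpen_inter_preimage ψ.open_source φ.open_target,
    ⟨(hc x₀ hx₀).1, ?_⟩, hφs.comp (ha.mono Set.inter_subset_left) fun y hy => hy.2, ?_, ?_⟩
  · simp [a, φ.map_source hx₀]
  · simp [a, φ.left_inv hx₀]
  · rintro y ⟨hy, hya⟩
    obtain ⟨h1, h2⟩ := hc _ (φ.map_target hya)
    refine ψ.injOn h1 hy (h2.trans ?_)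
    rw [φ.right_inv hya]
    simp only [a, map_add, hR, ← (hc x₀ hx₀).2]
    abel

/-- A function whose derivative vanishes on the vertical spaces of a submersion is locally constant
on its fibers. -/
theorem eventually_eq_of_vertical_derivative_zero {q : N → M}
    (hq : Manifold.IsSubmersion 𝓘(ℝ, E) 𝓘(ℝ, E') ∞ q) {U : Set N} (hU : IsOpen U) {f : N → ℝ}
    (hf : ContMDiffOn 𝓘(ℝ, E) 𝓘(ℝ, ℝ) ∞ f U)
    (hd : ∀ x ∈ U, ∀ v : TangentSpace 𝓘(ℝ, E) x, mfderiv 𝓘(ℝ, E) 𝓘(ℝ, E') q x v = 0 →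
      mvfderiv 𝓘(ℝ, E) f x v = 0) {x₀ : N} (hx₀U : x₀ ∈ U) :
    ∀ᶠ x in 𝓝 x₀, q x = q x₀ → f x = f x₀ := by
  obtain ⟨φ, ψ, L, R, hφ, hψ, hx₀, hc, hR⟩ := exists_submersion_charts hq x₀
  have hφs := contMDiffOn_symm_of_mem_maximalAtlas hφ
  have hψs := contMDiffOn_of_mem_maximalAtlas hψ
  have hψd : ψ.MDifferentiable 𝓘(ℝ, E') 𝓘(ℝ, E') :=
    ⟨hψs.mdifferentiableOn (by simp),
      (contMDiffOn_symm_of_mem_maximalAtlas hψ).mdifferentiableOn (by simp)⟩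
  obtain ⟨r, hr, hball⟩ := Metric.isOpen_iff.1 (φ.symm.isOpen_inter_preimage hU) (φ x₀)
    ⟨φ.map_source hx₀, by simpa [φ.left_inv hx₀] using hx₀U⟩
  have hev : ∀ᶠ x in 𝓝 x₀, x ∈ φ.source ∧ φ x ∈ Metric.ball (φ x₀) r :=
    Filter.Eventually.and (φ.open_source.mem_nhds hx₀)
      ((φ.continuousAt hx₀) (Metric.ball_mem_nhds _ hr))
  filter_upwards [hev] with x hx hqx
  -- As `x` and `x₀` lie in one fiber, `d` is in the kernel of `L`. The chart segment between them
  -- thus has vertical velocity, and `f` has zero derivative along it.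
  set d : E := φ x - φ x₀ with hd'
  have hLd : L d = 0 := by
    rw [hd', map_sub, ← (hc x hx.1).2, ← (hc x₀ hx₀).2, hqx, sub_self]
  let f' : E → ℝ := f ∘ φ.symm
  have hf' : ∀ z ∈ Metric.ball (φ x₀) r, DifferentiableAt ℝ f' z ∧ fderiv ℝ f' z d = 0 := by
    intro z hz
    obtain ⟨hzt, hzU⟩ := hball hz
    have hφz : MDifferentiableAt 𝓘(ℝ, E) 𝓘(ℝ, E) φ.symm z :=
      (hφs.contMDiffAt (φ.open_target.mem_nhds hzt)).mdifferentiableAt (by simp)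
    have hfz : MDifferentiableAt 𝓘(ℝ, E) 𝓘(ℝ, ℝ) f (φ.symm z) :=
      (hf.contMDiffAt (hU.mem_nhds hzU)).mdifferentiableAt (by simp)
    refine ⟨(hfz.comp z hφz).differentiableAt, ?_⟩
    rw [← mfderiv_eq_fderiv]
    refine (mfderiv_comp_apply z hfz hφz d).trans (hd _ hzU _ ?_)
    have hsrc := φ.map_target hzt
    have hqz : MDifferentiableAt 𝓘(ℝ, E) 𝓘(ℝ, E') q (φ.symm z) :=
      (hq.contMDiff.contMDiffAt).mdifferentiableAt (by simp)
    -- The derivative of `ψ` is injective, so it suffices to differentiate `ψ ∘ q ∘ φ.symm`, which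
    -- is `L` near `z`.
    refine (injective_iff_map_eq_zero _).1 (hψd.mfderiv_injective (hc _ hsrc).1) _ ?_
    have h1 : mfderiv 𝓘(ℝ, E) 𝓘(ℝ, E') (ψ ∘ q ∘ φ.symm) z d =
        mfderiv 𝓘(ℝ, E') 𝓘(ℝ, E') ψ (q (φ.symm z)) (mfderiv 𝓘(ℝ, E) 𝓘(ℝ, E') q (φ.symm z)
          (mfderiv 𝓘(ℝ, E) 𝓘(ℝ, E) φ.symm z d)) := by
      refine (mfderiv_comp_apply z (hψd.mdifferentiableAt (hc _ hsrc).1) (hqz.comp z hφz) _).trans ?_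
      exact congrArg (mfderiv 𝓘(ℝ, E') 𝓘(ℝ, E') ψ (q (φ.symm z))) (mfderiv_comp_apply z hqz hφz _)
    have h2 : (ψ ∘ q ∘ φ.symm) =ᶠ[𝓝 z] L := by
      filter_upwards [φ.open_target.mem_nhds hzt] with w hw
      simp only [Function.comp_apply]
      rw [(hc _ (φ.map_target hw)).2, φ.right_inv hw]
    rw [← h1]
    have h3 : mfderiv 𝓘(ℝ, E) 𝓘(ℝ, E') (ψ ∘ q ∘ φ.symm) z = mfderiv 𝓘(ℝ, E) 𝓘(ℝ, E') L z :=
      h2.mfderiv_eq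
    refine (DFunLike.congr_fun h3 d).trans ?_
    rw [mfderiv_eq_fderiv, L.fderiv]
    exact hLd
  let γ : ℝ → E := fun t => φ x₀ + t • d
  have hγ : ∀ t, HasDerivAt γ d t := fun t => by
    have h := ((hasDerivAt_id t).smul_const d).const_add (φ x₀)
    rw [one_smul] at h
    exact h
  have hγc : Continuous γ := by fun_prop
  have hconv : Convex ℝ (γ ⁻¹' Metric.ball (φ x₀) r) := by
    have h1 : Convex ℝ ((fun t : ℝ => t • d) ⁻¹' Metric.ball 0 r) :=
      (convex_ball 0 r).is_linear_preimage
        (IsLinearMap.mk (fun a b => add_smul a b d) (fun a b => mul_smul a b d))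
    convert h1 using 1
    ext t
    simp [γ]
  have hS : IsOpen (γ ⁻¹' Metric.ball (φ x₀) r) := Metric.isOpen_ball.preimage hγc
  have hder : ∀ t ∈ γ ⁻¹' Metric.ball (φ x₀) r, HasDerivAt (f' ∘ γ) 0 t := by
    intro t ht
    obtain ⟨h1, h2⟩ := hf' _ ht
    rw [← h2]
    exact h1.hasFDerivAt.comp_hasDerivAt t (hγ t)
  have h0 : (0 : ℝ) ∈ γ ⁻¹' Metric.ball (φ x₀) r := by simp [γ, hr]
  have h1 : (1 : ℝ) ∈ γ ⁻¹' Metric.ball (φ x₀) r := by simpa [γ, d] using hx.2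
  have := hS.is_const_of_deriv_eq_zero hconv.isPreconnected
    (fun t ht => (hder t ht).differentiableAt.differentiableWithinAt)
    (fun t ht => (hder t ht).deriv) h1 h0
  simpa [f', γ, d, φ.left_inv hx.1, φ.left_inv hx₀] using this

/-- A function whose derivative vanishes on the vertical spaces of a submersion is constant on its
connected fibers. -/
theorem eq_of_vertical_derivative_zero {q : N → M}
    (hq : Manifold.IsSubmersion 𝓘(ℝ, E) 𝓘(ℝ, E') ∞ q) {y : M} (hy : IsPreconnected (q ⁻¹' {y}))
    {U : Set N} (hU : IsOpen U) (hyU : q ⁻¹' {y} ⊆ U) {f : N → ℝ}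
    (hf : ContMDiffOn 𝓘(ℝ, E) 𝓘(ℝ, ℝ) ∞ f U)
    (hd : ∀ x ∈ U, ∀ v : TangentSpace 𝓘(ℝ, E) x, mfderiv 𝓘(ℝ, E) 𝓘(ℝ, E') q x v = 0 →
      mvfderiv 𝓘(ℝ, E) f x v = 0) {x x' : N} (hx : q x = y) (hx' : q x' = y) : f x = f x' := by
  have hlc : IsLocallyConstant fun p : q ⁻¹' {y} => f p := by
    rw [IsLocallyConstant.iff_eventually_eq]
    intro p
    have h := eventually_eq_of_vertical_derivative_zero hq hU hf hd (hyU p.2)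
    have h2 : ∀ᶠ p' : q ⁻¹' {y} in 𝓝 p, q p' = q p → f p' = f p :=
      continuous_subtype_val.continuousAt.eventually h
    filter_upwards [h2] with p' hp'
    exact hp' (by rw [p'.2, p.2])
  have : PreconnectedSpace (q ⁻¹' {y}) := Subtype.preconnectedSpace hy
  exact hlc.apply_eq_of_isPreconnected isPreconnected_univ (x := ⟨x, hx⟩) (y := ⟨x', hx'⟩)
    trivial trivial

end Submersion

/-! ### Invariant horizontal complements, connection forms and horizontal lifts -/

section Connection

variable {E : Type*} [NormedAddCommGroup E] [NormedSpace ℝ E] [FiniteDimensional ℝ E]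
  {N : Type*} [TopologicalSpace N] [ChartedSpace E N] [IsManifold 𝓘(ℝ, E) ∞ N]
  {E' : Type*} [NormedAddCommGroup E'] [NormedSpace ℝ E'] [FiniteDimensional ℝ E']
  {M : Type*} [TopologicalSpace M] [ChartedSpace E' M] [IsManifold 𝓘(ℝ, E') ∞ M]
  {H : ∀ x : N, Submodule ℝ (TangentSpace 𝓘(ℝ, E) x)} {ξ : ∀ x : N, TangentSpace 𝓘(ℝ, E) x}
  {q : N → M} {α : ∀ x : N, TangentSpace 𝓘(ℝ, E) x →ₗ[ℝ] ℝ}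
  {G : ∀ x : N, H x ≃ₗ[ℝ] TangentSpace 𝓘(ℝ, E') (q x)}

/-- `H` is an invariant complement of the vertical bundle of the quotient `q` by `ξ`, with
connection form `α` and with `G x : H x ≃ T_{q x} M` the restriction of the derivative of `q`. -/
structure IsConnection (H : ∀ x : N, Submodule ℝ (TangentSpace 𝓘(ℝ, E) x))
    (ξ : ∀ x : N, TangentSpace 𝓘(ℝ, E) x) (q : N → M)
    (α : ∀ x : N, TangentSpace 𝓘(ℝ, E) x →ₗ[ℝ] ℝ)
    (G : ∀ x : N, H x ≃ₗ[ℝ] TangentSpace 𝓘(ℝ, E') (q x)) : Prop where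
  isDistribution : IsDistribution H (Module.finrank ℝ E')
  isTransversalAut : IsTransversalAut H ξ
  isQuotient : IsQuotient E' ξ q
  ker_form : ∀ x, LinearMap.ker (α x) = H x
  form_apply : ∀ x, α x (ξ x) = 1
  lift_apply : ∀ x (h : H x), G x h = mfderiv 𝓘(ℝ, E) 𝓘(ℝ, E') q x h
  finrank_eq : Module.finrank ℝ E = Module.finrank ℝ E' + 1

/-- The horizontal lift of a vector field. -/
def hlift (G : ∀ x : N, H x ≃ₗ[ℝ] TangentSpace 𝓘(ℝ, E') (q x))
    (Y : ∀ y : M, TangentSpace 𝓘(ℝ, E') y) (x : N) : H x := (G x).symm (Y (q x))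

namespace IsConnection

variable (h : IsConnection H ξ q α G)
include h

theorem contMDiff : ContMDiff 𝓘(ℝ, E) 𝓘(ℝ, E') ∞ q := h.isQuotient.submersion.contMDiff

theorem continuous : Continuous q := h.contMDiff.continuous

theorem mfderiv_xi (x : N) : mfderiv 𝓘(ℝ, E) 𝓘(ℝ, E') q x (ξ x) = 0 := by
  have : ξ x ∈ LinearMap.ker (mfderiv 𝓘(ℝ, E) 𝓘(ℝ, E') q x).toLinearMap := by
    rw [h.isQuotient.ker_eq]; exact Submodule.mem_span_singleton_self _
  exact this

theorem form_eq_zero_iff {x : N} {v : TangentSpace 𝓘(ℝ, E) x} : α x v = 0 ↔ v ∈ H x := by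
  rw [← h.ker_form, LinearMap.mem_ker]

theorem mfderiv_hlift (Y : ∀ y : M, TangentSpace 𝓘(ℝ, E') y) (x : N) :
    mfderiv 𝓘(ℝ, E) 𝓘(ℝ, E') q x (hlift G Y x) = Y (q x) := by
  rw [← h.lift_apply]; exact (G x).apply_symm_apply _

theorem sub_smul_mem (x : N) (v : TangentSpace 𝓘(ℝ, E) x) : v - α x v • ξ x ∈ H x := by
  rw [← h.form_eq_zero_iff]; simp [h.form_apply]

/-- A vertical vector is a multiple of `ξ`, and `α` returns the factor. Identities between tangent
vectors on `N` are checked below by applying `α` and the derivative of `q`. -/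
theorem eq_zero_of {x : N} {v : TangentSpace 𝓘(ℝ, E) x} (h1 : α x v = 0)
    (h2 : mfderiv 𝓘(ℝ, E) 𝓘(ℝ, E') q x v = 0) : v = 0 := by
  have h3 : v ∈ LinearMap.ker (mfderiv 𝓘(ℝ, E) 𝓘(ℝ, E') q x).toLinearMap := h2
  rw [h.isQuotient.ker_eq, Submodule.mem_span_singleton] at h3
  obtain ⟨c, rfl⟩ := h3
  rw [map_smul, h.form_apply, smul_eq_mul, mul_one] at h1
  rw [h1, zero_smul]

/-- A local frame of `H` together with `ξ` is a frame of the tangent bundle, and `α` reads off the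
smooth coefficient of `ξ`. The index `none` stands for `ξ`. -/
theorem contMDiffAt_form {Z : ∀ x : N, TangentSpace 𝓘(ℝ, E) x} {x₀ : N}
    (hZ : ContMDiffAt 𝓘(ℝ, E) 𝓘(ℝ, E).tangent ∞
      (fun x => (⟨x, Z x⟩ : TangentBundle 𝓘(ℝ, E) N)) x₀) :
    ContMDiffAt 𝓘(ℝ, E) 𝓘(ℝ, ℝ) ∞ (fun x => α x (Z x)) x₀ := by
  obtain ⟨U, hU, hx₀, X, hX, hfr⟩ := h.isDistribution x₀
  have hc : ∀ x ∈ U, ∃ c : Fin (Module.finrank ℝ E') → ℝ,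
      ∑ i, c i • X i x = Z x - α x (Z x) • ξ x := fun x hx => by
    have h1 := h.sub_smul_mem x (Z x)
    rw [← (hfr x hx).2] at h1
    exact (Submodule.mem_span_range_iff_exists_fun ℝ).1 h1
  choose! c hc using hc
  let e : Option (Fin (Module.finrank ℝ E')) → ∀ x : N, TangentSpace 𝓘(ℝ, E) x :=
    fun o x => o.elim (ξ x) fun i => X i x
  let c' : N → Option (Fin (Module.finrank ℝ E')) → ℝ := fun x o => o.elim (α x (Z x)) (c x)
  have h1 := contMDiffAt_coeff_along (f := id) (e := e) (v := Z) (c := c') (x₀ := x₀)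
    (by simp [h.finrank_eq]) (fun o => ?_) ?_ hZ ?_
  · exact (contMDiffAt_pi_space.1 h1) none
  · cases o with
    | none => exact h.isTransversalAut.smooth.contMDiffAt isOpen_univ trivial
    | some i => exact (hX i).contMDiffAt hU hx₀
  · rw [linearIndependent_option]
    refine ⟨(hfr x₀ hx₀).1, ?_⟩
    intro h2
    apply h.isTransversalAut.transversal x₀
    rw [← (hfr x₀ hx₀).2]
    exact h2
  · filter_upwards [hU.mem_nhds hx₀] with x hx
    rw [Fintype.sum_option]
    simp only [c', e, Option.elim]
    rw [hc x hx]
    abel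

theorem isContactForm : IsContactForm H α :=
  ⟨fun _ _ hU hX _ hx => (h.contMDiffAt_form (hX.contMDiffAt hU hx)).contMDiffWithinAt, h.ker_form⟩

/-- The derivative of `q` maps a local frame of `H` to a frame along `q`. The coefficients of `Y ∘
q` in it are smooth, and they are also the coefficients of the lift in the original frame. -/
theorem smoothSec_hlift {V : Set M} (hV : IsOpen V) {Y : ∀ y : M, TangentSpace 𝓘(ℝ, E') y}
    (hY : SmoothVF V Y) : SmoothSec H (q ⁻¹' V) (hlift G Y) := by
  intro x₀ hx₀V
  refine ContMDiffAt.contMDiffWithinAt ?_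
  obtain ⟨U, hU, hx₀, X, hX, hfr⟩ := h.isDistribution x₀
  have hc : ∀ x ∈ U, ∃ c : Fin (Module.finrank ℝ E') → ℝ,
      ∑ i, c i • X i x = hlift G Y x := fun x hx => by
    refine (Submodule.mem_span_range_iff_exists_fun ℝ).1 ?_
    exact (hfr x hx).2.ge (hlift G Y x).2
  choose! c hc using hc
  have hcs : ContMDiffAt 𝓘(ℝ, E) 𝓘(ℝ, Fin (Module.finrank ℝ E') → ℝ) ∞ c x₀ := by
    refine contMDiffAt_coeff_along (f := q)
      (e := fun i x => mfderiv 𝓘(ℝ, E) 𝓘(ℝ, E') q x (X i x)) (v := fun x => Y (q x)) (by simp)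
      (fun i => contMDiffAt_mfderiv_apply h.contMDiff ((hX i).contMDiffAt hU hx₀)) ?_
      (hY.comp hV h.contMDiff.contMDiffAt hx₀V) ?_
    · refine (hfr x₀ hx₀).1.map (f := (mfderiv 𝓘(ℝ, E) 𝓘(ℝ, E') q x₀).toLinearMap) ?_
      rw [(hfr x₀ hx₀).2, Submodule.disjoint_def]
      exact fun v hv hv' => h.eq_zero_of (h.form_eq_zero_iff.2 hv) hv'
    · filter_upwards [hU.mem_nhds hx₀] with x hx
      rw [← h.mfderiv_hlift Y x, ← hc x hx, map_sum]
      simp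
  have hs : ContMDiffAt 𝓘(ℝ, E) 𝓘(ℝ, E).tangent ∞
      (fun x => (⟨x, ∑ i, c x i • X i x⟩ : TangentBundle 𝓘(ℝ, E) N)) x₀ :=
    ContMDiffAt.sum_section fun i _ =>
      ((contMDiffAt_pi_space.1 hcs) i).smul_section ((hX i).contMDiffAt hU hx₀)
  refine hs.congr_of_eventuallyEq ?_
  filter_upwards [hU.mem_nhds hx₀] with x hx
  rw [hc x hx]

theorem mvfderiv_comp_xi {F : Type*} [NormedAddCommGroup F] [NormedSpace ℝ F] {g : M → F} {x : N}
    (hg : ContMDiffAt 𝓘(ℝ, E') 𝓘(ℝ, F) ∞ g (q x)) :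
    mvfderiv 𝓘(ℝ, E) (fun y => g (q y)) x (ξ x) = 0 := by
  refine (mfderiv_comp_apply (g := g) x (hg.mdifferentiableAt (by simp))
    (h.contMDiff.contMDiffAt.mdifferentiableAt (by simp)) (ξ x)).trans ?_
  rw [h.mfderiv_xi, map_zero]
  rfl

/-- Horizontal lifts commute with `ξ`. -/
theorem mlieBracket_hlift {V : Set M} (hV : IsOpen V) {Y : ∀ y : M, TangentSpace 𝓘(ℝ, E') y}
    (hY : SmoothVF V Y) {x₀ : N} (hx₀ : q x₀ ∈ V) :
    VectorField.mlieBracket 𝓘(ℝ, E) ξ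
      (fun x => (hlift G Y x : TangentSpace 𝓘(ℝ, E) x)) x₀ = 0 := by
  have hVo := hV.preimage h.continuous
  have hX := h.smoothSec_hlift hV hY
  refine h.eq_zero_of (h.form_eq_zero_iff.2
    (h.isTransversalAut.bracket_mem _ _ hVo hX x₀ hx₀)) ?_
  -- The bracket is horizontal; it remains to see that it is vertical. It is applied to the function
  -- `φ ∘ q` as a commutator: the lift turns this function into one that factors through `q`, which
  -- `ξ` annihilates, and `ξ` turns it into zero.
  set φ := extChartAt 𝓘(ℝ, E') (q x₀) with hφ
  have hφs : ∀ y ∈ φ.source, ContMDiffAt 𝓘(ℝ, E') 𝓘(ℝ, E') ∞ φ y := fun y hy =>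
    contMDiffAt_extChartAt' (by simpa [φ] using hy)
  have hq : ∀ x, MDifferentiableAt 𝓘(ℝ, E) 𝓘(ℝ, E') q x := fun x =>
    h.contMDiff.contMDiffAt.mdifferentiableAt (by simp)
  have hsrc : ∀ᶠ x in 𝓝 x₀, q x ∈ φ.source :=
    h.continuous.continuousAt.eventually (extChartAt_source_mem_nhds (q x₀))
  have hd : ∀ x, q x ∈ φ.source → ∀ v, mvfderiv 𝓘(ℝ, E) (φ ∘ q) x v =
      mvfderiv 𝓘(ℝ, E') φ (q x) (mfderiv 𝓘(ℝ, E) 𝓘(ℝ, E') q x v) := fun x hx v =>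
    mfderiv_comp_apply x ((hφs _ hx).mdifferentiableAt (by simp)) (hq x) v
  have hbr := mvfderiv_apply_mlieBracket (g := φ ∘ q) (V := ξ)
    (W := fun x => (hlift G Y x : TangentSpace 𝓘(ℝ, E) x)) (x₀ := x₀)
    ((hφs _ (mem_extChartAt_source _)).comp x₀ h.contMDiff.contMDiffAt)
    (h.isTransversalAut.smooth.mdifferentiableAt isOpen_univ trivial)
    (SmoothVF.mdifferentiableAt hX hVo hx₀)
  set τ := trivializationAt E' (TangentSpace 𝓘(ℝ, E') : M → Type _) (q x₀)
  -- The derivative of the chart is the trivialization, so the chart components of `Y` are smooth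
  -- functions on `M`.
  have hτ : ∀ y ∈ φ.source, ∀ v : TangentSpace 𝓘(ℝ, E') y,
      mvfderiv 𝓘(ℝ, E') φ y v = (τ ⟨y, v⟩).2 := fun y hy v => by
    have h1 := TangentBundle.continuousLinearMapAt_trivializationAt (I := 𝓘(ℝ, E'))
      (x₀ := q x₀) (x := y) (by simpa [φ] using hy)
    refine (DFunLike.congr_fun h1 v).symm.trans ?_
    exact Bundle.Trivialization.continuousLinearMapAt_apply_of_mem (R := ℝ) (e := τ)
      (hb := by simpa [φ, τ] using hy) v
  have h1 : mvfderiv 𝓘(ℝ, E) (fun x => mvfderiv 𝓘(ℝ, E) (φ ∘ q) x (hlift G Y x)) x₀ (ξ x₀) = 0 := by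
    have h2 : (fun x => mvfderiv 𝓘(ℝ, E) (φ ∘ q) x (hlift G Y x)) =ᶠ[𝓝 x₀]
        fun x => (fun y => (τ ⟨y, Y y⟩).2) (q x) := by
      filter_upwards [hsrc] with x hx
      rw [hd x hx, h.mfderiv_hlift, hτ _ hx]
    refine (DFunLike.congr_fun h2.mfderiv_eq (ξ x₀)).trans ?_
    exact h.mvfderiv_comp_xi ((Bundle.contMDiffAt_section _).1 (hY.contMDiffAt hV hx₀))
  have h2 : mvfderiv 𝓘(ℝ, E) (fun x => mvfderiv 𝓘(ℝ, E) (φ ∘ q) x (ξ x)) x₀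
      (hlift G Y x₀ : TangentSpace 𝓘(ℝ, E) x₀) = 0 := by
    have h3 : (fun x => mvfderiv 𝓘(ℝ, E) (φ ∘ q) x (ξ x)) =ᶠ[𝓝 x₀] fun x => 0 := by
      filter_upwards [hsrc] with x hx
      rw [hd x hx, h.mfderiv_xi, map_zero]
    refine (DFunLike.congr_fun h3.mfderiv_eq _).trans ?_
    rw [mfderiv_const]
    rfl
  rw [h1, h2, sub_zero, hd x₀ (mem_extChartAt_source _)] at hbr
  obtain ⟨T, hT⟩ := isInvertible_mfderiv_extChartAt (I := 𝓘(ℝ, E')) (mem_extChartAt_source (q x₀))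
  refine (injective_iff_map_eq_zero T).1 T.injective _ ?_
  exact (DFunLike.congr_fun hT _).trans hbr

/-- The connection form is invariant under the flow of `ξ`. -/
theorem mvfderiv_form {U : Set N} (hU : IsOpen U) {Z : ∀ x : N, TangentSpace 𝓘(ℝ, E) x}
    (hZ : SmoothVF U Z) {x : N} (hx : x ∈ U) :
    mvfderiv 𝓘(ℝ, E) (fun y => α y (Z y)) x (ξ x) =
      α x (VectorField.mlieBracket 𝓘(ℝ, E) ξ Z x) := by
  let f : N → ℝ := fun y => α y (Z y)
  have hf : ∀ y ∈ U, ContMDiffAt 𝓘(ℝ, E) 𝓘(ℝ, ℝ) ∞ f y := fun y hy =>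
    h.contMDiffAt_form (hZ.contMDiffAt hU hy)
  have hξ : ∀ y, ContMDiffAt 𝓘(ℝ, E) 𝓘(ℝ, E).tangent ∞
      (fun x => (⟨x, ξ x⟩ : TangentBundle 𝓘(ℝ, E) N)) y := fun y =>
    h.isTransversalAut.smooth.contMDiffAt isOpen_univ trivial
  have hfξ : ∀ y ∈ U, ContMDiffAt 𝓘(ℝ, E) 𝓘(ℝ, E).tangent ∞
      (fun x => (⟨x, (f • ξ) x⟩ : TangentBundle 𝓘(ℝ, E) N)) y := fun y hy =>
    (hf y hy).smul_section (hξ y)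
  -- With `Z = η + fξ`, the bracket `[ξ, η]` stays in the kernel of `α`, while `[ξ, fξ] = (ξ · f)
  -- ξ`.
  let η : ∀ y, H y := fun y => ⟨Z y - f y • ξ y, h.sub_smul_mem y (Z y)⟩
  have hη : SmoothSec H U η := fun y hy =>
    ((hZ.contMDiffAt hU hy).sub_section (hfξ y hy)).contMDiffWithinAt
  have h1 := h.form_eq_zero_iff.2 (h.isTransversalAut.bracket_mem U η hU hη x hx)
  have h2 : Z = (fun y => (η y : TangentSpace 𝓘(ℝ, E) y)) + f • ξ := by
    funext y; simp [η]
  have h3 : VectorField.mlieBracket 𝓘(ℝ, E) ξ Z x =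
      VectorField.mlieBracket 𝓘(ℝ, E) ξ (fun y => (η y : TangentSpace 𝓘(ℝ, E) y)) x +
        mvfderiv 𝓘(ℝ, E) f x (ξ x) • ξ x := by
    conv_lhs => rw [h2]
    rw [VectorField.mlieBracket_add_right (SmoothVF.mdifferentiableAt hη hU hx)
      ((hfξ x hx).mdifferentiableAt (by simp)), VectorField.mlieBracket_smul_right
      ((hf x hx).mdifferentiableAt (by simp)) ((hξ x).mdifferentiableAt (by simp))]
    simp
  rw [h3, map_add, h1, map_smul, h.form_apply]
  simp [f]

end IsConnection
end Connection

/-! ### Multilinear expansions -/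

section Expansion

variable {V ι : Type*} [AddCommGroup V] [Module ℝ V] [Fintype ι] {k : ℕ}

theorem alternatingMap_sum_smul (φ : V [⋀^Fin k]→ₗ[ℝ] ℝ) (c : Fin k → ι → ℝ) (Y : ι → V) :
    φ (fun i => ∑ j, c i j • Y j) = ∑ J : Fin k → ι, (∏ i, c i (J i)) * φ (fun i => Y (J i)) := by
  classical
  refine (φ.toMultilinearMap.map_sum fun i j => c i j • Y j).trans ?_
  refine Finset.sum_congr rfl fun J _ => ?_
  exact φ.toMultilinearMap.map_smul_univ (fun i => c i (J i)) fun i => Y (J i)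

/-- The update replaces row `i` of the coefficients by `b`. With derivatives as `b`, the result is
the `i`-th term of the product rule for `∏ i, c i (J i)`. -/
theorem alternatingMap_update_sum_smul (φ : V [⋀^Fin k]→ₗ[ℝ] ℝ) (c : Fin k → ι → ℝ) (Y : ι → V)
    (i : Fin k) (b : ι → ℝ) :
    φ (Function.update (fun i => ∑ j, c i j • Y j) i (∑ j, b j • Y j)) =
      ∑ J : Fin k → ι, (b (J i) * ∏ l ∈ Finset.univ.erase i, c l (J l)) *
        φ (fun i => Y (J i)) := by
  classical
  have h1 : Function.update (fun i => ∑ j, c i j • Y j) i (∑ j, b j • Y j) =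
      fun l => ∑ j, Function.update c i b l j • Y j := by
    funext l
    rcases eq_or_ne l i with rfl | hl
    · simp
    · simp [hl]
  rw [h1, alternatingMap_sum_smul]
  refine Finset.sum_congr rfl fun J _ => ?_
  congr 1
  rw [← Finset.mul_prod_erase _ _ (Finset.mem_univ i)]
  congr 1
  · simp
  · refine Finset.prod_congr rfl fun l hl => ?_
    rw [Function.update_of_ne (Finset.ne_of_mem_erase hl)]

end Expansion

/-! ### Sum and product rules for directional derivatives and brackets -/

section Derivation

variable {E : Type*} [NormedAddCommGroup E] [NormedSpace ℝ E]
  {N : Type*} [TopologicalSpace N] [ChartedSpace E N] {ι : Type*} {x : N}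

theorem mvfderiv_fun_sum_apply (s : Finset ι) {f : ι → N → ℝ}
    (hf : ∀ i ∈ s, MDifferentiableAt 𝓘(ℝ, E) 𝓘(ℝ, ℝ) (f i) x) (v : TangentSpace 𝓘(ℝ, E) x) :
    MDifferentiableAt 𝓘(ℝ, E) 𝓘(ℝ, ℝ) (fun y => ∑ i ∈ s, f i y) x ∧
    mvfderiv 𝓘(ℝ, E) (fun y => ∑ i ∈ s, f i y) x v = ∑ i ∈ s, mvfderiv 𝓘(ℝ, E) (f i) x v := by
  classical
  induction s using Finset.induction_on with
  | empty =>
    simp only [Finset.sum_empty]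
    exact ⟨mdifferentiableAt_const, by rw [mvfderiv_const]; rfl⟩
  | insert a s ha ih =>
    obtain ⟨h1, h2⟩ := ih fun i hi => hf i (Finset.mem_insert_of_mem hi)
    have h3 := hf a (Finset.mem_insert_self a s)
    simp only [Finset.sum_insert ha]
    refine ⟨h3.add h1, ?_⟩
    rw [← h2]
    exact DFunLike.congr_fun (mvfderiv_add h3 h1) v

theorem mvfderiv_fun_mul_apply {f g : N → ℝ} (hf : MDifferentiableAt 𝓘(ℝ, E) 𝓘(ℝ, ℝ) f x)
    (hg : MDifferentiableAt 𝓘(ℝ, E) 𝓘(ℝ, ℝ) g x) (v : TangentSpace 𝓘(ℝ, E) x) :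
    mvfderiv 𝓘(ℝ, E) (fun y => f y * g y) x v =
      f x * mvfderiv 𝓘(ℝ, E) g x v + mvfderiv 𝓘(ℝ, E) f x v * g x := by
  refine (DFunLike.congr_fun (mvfderiv_mul hf hg) v).trans ?_
  simp [mul_comm]

theorem mvfderiv_fun_prod_apply [DecidableEq ι] (s : Finset ι) {f : ι → N → ℝ}
    (hf : ∀ i ∈ s, MDifferentiableAt 𝓘(ℝ, E) 𝓘(ℝ, ℝ) (f i) x) (v : TangentSpace 𝓘(ℝ, E) x) :
    MDifferentiableAt 𝓘(ℝ, E) 𝓘(ℝ, ℝ) (fun y => ∏ i ∈ s, f i y) x ∧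
    mvfderiv 𝓘(ℝ, E) (fun y => ∏ i ∈ s, f i y) x v =
      ∑ i ∈ s, mvfderiv 𝓘(ℝ, E) (f i) x v * ∏ l ∈ s.erase i, f l x := by
  induction s using Finset.induction_on with
  | empty =>
    simp only [Finset.prod_empty, Finset.sum_empty]
    exact ⟨mdifferentiableAt_const, by rw [mvfderiv_const]; rfl⟩
  | insert a s ha ih =>
    obtain ⟨h1, h2⟩ := ih fun i hi => hf i (Finset.mem_insert_of_mem hi)
    have h3 := hf a (Finset.mem_insert_self a s)
    simp only [Finset.prod_insert ha]
    refine ⟨h3.mul h1, ?_⟩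
    rw [mvfderiv_fun_mul_apply h3 h1, h2, Finset.sum_insert ha, Finset.erase_insert ha, add_comm,
      Finset.mul_sum]
    congr 1
    refine Finset.sum_congr rfl fun i hi => ?_
    have hia : a ≠ i := fun h => ha (h ▸ hi)
    rw [Finset.erase_insert_of_ne hia, Finset.prod_insert (fun h => ha (Finset.mem_of_mem_erase h))]
    ring

end Derivation

theorem mlieBracket_sum_smul_right {E : Type*} [NormedAddCommGroup E] [NormedSpace ℝ E]
    [CompleteSpace E] {N : Type*} [TopologicalSpace N] [ChartedSpace E N] [IsManifold 𝓘(ℝ, E) ∞ N]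
    {ι : Type*} {x : N} {ξ : ∀ x : N, TangentSpace 𝓘(ℝ, E) x} (s : Finset ι) {c : ι → N → ℝ}
    {L : ι → ∀ x : N, TangentSpace 𝓘(ℝ, E) x}
    (hc : ∀ i ∈ s, ContMDiffAt 𝓘(ℝ, E) 𝓘(ℝ, ℝ) ∞ (c i) x)
    (hL : ∀ i ∈ s, ContMDiffAt 𝓘(ℝ, E) 𝓘(ℝ, E).tangent ∞
      (fun x => (⟨x, L i x⟩ : TangentBundle 𝓘(ℝ, E) N)) x) :
    VectorField.mlieBracket 𝓘(ℝ, E) ξ (fun y => ∑ i ∈ s, c i y • L i y) x =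
      ∑ i ∈ s, (mvfderiv 𝓘(ℝ, E) (c i) x (ξ x) • L i x +
        c i x • VectorField.mlieBracket 𝓘(ℝ, E) ξ (L i) x) := by
  classical
  induction s using Finset.induction_on with
  | empty =>
    simp only [Finset.sum_empty]
    exact congrFun VectorField.mlieBracket_zero_right x
  | insert a s ha ih =>
    have h1 := hc a (Finset.mem_insert_self a s)
    have h2 := hL a (Finset.mem_insert_self a s)
    have h3 : ContMDiffAt 𝓘(ℝ, E) 𝓘(ℝ, E).tangent ∞
        (fun x => (⟨x, ∑ i ∈ s, c i x • L i x⟩ : TangentBundle 𝓘(ℝ, E) N)) x :=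
      ContMDiffAt.sum_section fun i hi => (hc i (Finset.mem_insert_of_mem hi)).smul_section
        (hL i (Finset.mem_insert_of_mem hi))
    rw [Finset.sum_insert ha, ← ih (fun i hi => hc i (Finset.mem_insert_of_mem hi))
      (fun i hi => hL i (Finset.mem_insert_of_mem hi)),
      ← VectorField.mlieBracket_smul_right (h1.mdifferentiableAt (by simp))
        (h2.mdifferentiableAt (by simp)),
      ← VectorField.mlieBracket_add_right
        ((h1.smul_section h2).mdifferentiableAt (by simp)) (h3.mdifferentiableAt (by simp))]
    congr 1
    funext y
    exact Finset.sum_insert ha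

/-! ### Forms along maps -/

section Along

variable {E : Type*} [NormedAddCommGroup E] [NormedSpace ℝ E]
  {N : Type*} [TopologicalSpace N] [ChartedSpace E N]
  {E' : Type*} [NormedAddCommGroup E'] [NormedSpace ℝ E'] [FiniteDimensional ℝ E']
  {M : Type*} [TopologicalSpace M] [ChartedSpace E' M] [IsManifold 𝓘(ℝ, E') ∞ M]

/-- Coefficients of smooth vector fields along a map with respect to a local frame. -/
theorem exists_coeff_along {κ : Type*} {f : N → M} {x₀ : N}
    (hf : ContMDiffAt 𝓘(ℝ, E) 𝓘(ℝ, E') ∞ f x₀) {v : κ → ∀ x : N, TangentSpace 𝓘(ℝ, E') (f x)}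
    (hv : ∀ i, ContMDiffAt 𝓘(ℝ, E) 𝓘(ℝ, E').tangent ∞
      (fun x => (⟨f x, v i x⟩ : TangentBundle 𝓘(ℝ, E') M)) x₀) :
    ∃ (V : Set M) (Y : Fin (Module.finrank ℝ E') → ∀ y : M, TangentSpace 𝓘(ℝ, E') y)
      (c : κ → N → Fin (Module.finrank ℝ E') → ℝ),
      IsOpen V ∧ f x₀ ∈ V ∧ (∀ i, SmoothVF V (Y i)) ∧
      (∀ x, f x ∈ V → ∀ i, v i x = ∑ j, c i x j • Y j (f x)) ∧
      ∀ i, ContMDiffAt 𝓘(ℝ, E) 𝓘(ℝ, Fin (Module.finrank ℝ E') → ℝ) ∞ (c i) x₀ := by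
  obtain ⟨V, Y, hV, hx₀, hY, hli⟩ := exists_local_frame (E := E') (f x₀)
  have hc : ∀ i x, f x ∈ V → ∃ c : Fin (Module.finrank ℝ E') → ℝ,
      ∑ j, c j • Y j (f x) = v i x := fun i x hx => by
    refine (Submodule.mem_span_range_iff_exists_fun ℝ).1 ?_
    have : FiniteDimensional ℝ (TangentSpace 𝓘(ℝ, E') (f x)) := ‹FiniteDimensional ℝ E'›
    have h1 : Fintype.card (Fin (Module.finrank ℝ E')) =
      Module.finrank ℝ (TangentSpace 𝓘(ℝ, E') (f x)) := by rw [Fintype.card_fin]; rfl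
    rw [(hli _ hx).span_eq_top_of_card_eq_finrank' h1]
    trivial
  choose! c hc using hc
  refine ⟨V, Y, c, hV, hx₀, hY, fun x hx i => (hc i x hx).symm, fun i => ?_⟩
  refine contMDiffAt_coeff_along (f := f) (e := fun j x => Y j (f x)) (v := v i) (by simp)
    (fun j => (hY j).comp hV hf hx₀) (hli _ hx₀) (hv i) ?_
  filter_upwards [hf.continuousAt.eventually (hV.mem_nhds hx₀)] with x hx using hc i x hx

/-- Membership in `Omega` only tests fields on open subsets of `M`; expanding in a local frame
extends smoothness to fields along `f`. -/
theorem contMDiffAt_omega_along {k : ℕ} {φ : ∀ y : M, TangentSpace 𝓘(ℝ, E') y [⋀^Fin k]→ₗ[ℝ] ℝ}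
    (hφ : φ ∈ Omega E' M k) {f : N → M} {x₀ : N} (hf : ContMDiffAt 𝓘(ℝ, E) 𝓘(ℝ, E') ∞ f x₀)
    {v : Fin k → ∀ x : N, TangentSpace 𝓘(ℝ, E') (f x)}
    (hv : ∀ i, ContMDiffAt 𝓘(ℝ, E) 𝓘(ℝ, E').tangent ∞
      (fun x => (⟨f x, v i x⟩ : TangentBundle 𝓘(ℝ, E') M)) x₀) :
    ContMDiffAt 𝓘(ℝ, E) 𝓘(ℝ, ℝ) ∞ (fun x => φ (f x) fun i => v i x) x₀ := by
  obtain ⟨V, Y, c, hV, hx₀, hY, hc, hcs⟩ := exists_coeff_along hf hv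
  have h1 : ContMDiffAt 𝓘(ℝ, E) 𝓘(ℝ, ℝ) ∞
      (fun x => ∑ J : Fin k → Fin (Module.finrank ℝ E'), (∏ i, c i x (J i)) *
        φ (f x) (fun i => Y (J i) (f x))) x₀ := by
    refine ContMDiffAt.sum fun J _ => ContMDiffAt.mul ?_ ?_
    · exact ContMDiffAt.prod fun i _ => contMDiffAt_pi_space.1 (hcs i) (J i)
    · exact ((hφ V (fun i => Y (J i)) hV fun i => hY (J i)).contMDiffAt (hV.mem_nhds hx₀)).comp
        x₀ hf
  refine h1.congr_of_eventuallyEq ?_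
  filter_upwards [hf.continuousAt.eventually (hV.mem_nhds hx₀)] with x hx
  refine Eq.trans ?_ (alternatingMap_sum_smul (φ (f x)) (fun i => c i x) fun j => Y j (f x))
  simp only [hc x hx]

theorem pullback_mem_omega [IsManifold 𝓘(ℝ, E) ∞ N] {k : ℕ}
    {φ : ∀ y : M, TangentSpace 𝓘(ℝ, E') y [⋀^Fin k]→ₗ[ℝ] ℝ}
    (hφ : φ ∈ Omega E' M k) {q : N → M} (hq : ContMDiff 𝓘(ℝ, E) 𝓘(ℝ, E') ∞ q) :
    pullback E' q k φ ∈ Omega E N k := fun _ _ hU hX _ hx =>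
  (contMDiffAt_omega_along hφ hq.contMDiffAt fun i =>
    contMDiffAt_mfderiv_apply hq ((hX i).contMDiffAt hU hx)).contMDiffWithinAt

end Along

/-! ### Invariance of pullbacks -/

section Invariance

variable {E : Type*} [NormedAddCommGroup E] [NormedSpace ℝ E] [FiniteDimensional ℝ E]
  {N : Type*} [TopologicalSpace N] [ChartedSpace E N] [IsManifold 𝓘(ℝ, E) ∞ N]
  {E' : Type*} [NormedAddCommGroup E'] [NormedSpace ℝ E'] [FiniteDimensional ℝ E']
  {M : Type*} [TopologicalSpace M] [ChartedSpace E' M] [IsManifold 𝓘(ℝ, E') ∞ M]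
  {H : ∀ x : N, Submodule ℝ (TangentSpace 𝓘(ℝ, E) x)} {ξ : ∀ x : N, TangentSpace 𝓘(ℝ, E) x}
  {q : N → M} {α : ∀ x : N, TangentSpace 𝓘(ℝ, E) x →ₗ[ℝ] ℝ}
  {G : ∀ x : N, H x ≃ₗ[ℝ] TangentSpace 𝓘(ℝ, E') (q x)} {k : ℕ}

theorem restrict_mem_gammaH {ψ : ∀ x : N, TangentSpace 𝓘(ℝ, E) x [⋀^Fin k]→ₗ[ℝ] ℝ}
    (hψ : ψ ∈ Omega E N k) : restrict H k ψ ∈ GammaH H k := fun U X hU hX =>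
  hψ U (fun i x => X i x) hU hX

theorem IsLieDeriv.restrict {ψ : ∀ x : N, TangentSpace 𝓘(ℝ, E) x [⋀^Fin k]→ₗ[ℝ] ℝ}
    (hψ : IsLieDeriv ξ ψ 0) : IsLieDerivH H ξ (restrict H k ψ) 0 := by
  intro U X hU hX x hx Z hZ
  refine (hψ U (fun i x => X i x) hU hX x hx).trans ?_
  congr 1
  refine Finset.sum_congr rfl fun i _ => ?_
  refine congrArg (ψ x) ?_
  funext j
  rcases eq_or_ne j i with rfl | hj
  · simp [hZ]
  · simp [hj]

namespace IsConnection

variable (h : IsConnection H ξ q α G)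
include h

/-- The derivative of `q` on `[ξ, X]` is the derivative of the coefficients along `ξ`. -/
theorem mfderiv_mlieBracket {U : Set N} (hU : IsOpen U) {X : ∀ x : N, TangentSpace 𝓘(ℝ, E) x}
    (hX : SmoothVF U X) {x₀ : N} (hx₀ : x₀ ∈ U) {ι : Type*} [Fintype ι] {V : Set M} (hV : IsOpen V)
    (hx₀V : q x₀ ∈ V) {Y : ι → ∀ y : M, TangentSpace 𝓘(ℝ, E') y} (hY : ∀ j, SmoothVF V (Y j))
    {c : N → ι → ℝ} (hcs : ∀ j, ContMDiffAt 𝓘(ℝ, E) 𝓘(ℝ, ℝ) ∞ (fun x => c x j) x₀)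
    (hc : ∀ x, q x ∈ V → mfderiv 𝓘(ℝ, E) 𝓘(ℝ, E') q x (X x) = ∑ j, c x j • Y j (q x)) :
    mfderiv 𝓘(ℝ, E) 𝓘(ℝ, E') q x₀ (VectorField.mlieBracket 𝓘(ℝ, E) ξ X x₀) =
      ∑ j, mvfderiv 𝓘(ℝ, E) (fun x => c x j) x₀ (ξ x₀) • Y j (q x₀) := by
  have hL : ∀ j, ContMDiffAt 𝓘(ℝ, E) 𝓘(ℝ, E).tangent ∞
      (fun x => (⟨x, hlift G (Y j) x⟩ : TangentBundle 𝓘(ℝ, E) N)) x₀ := fun j =>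
    SmoothVF.contMDiffAt (h.smoothSec_hlift hV (hY j)) (hV.preimage h.continuous) hx₀V
  have hξ : ContMDiffAt 𝓘(ℝ, E) 𝓘(ℝ, E).tangent ∞
      (fun x => (⟨x, ξ x⟩ : TangentBundle 𝓘(ℝ, E) N)) x₀ :=
    h.isTransversalAut.smooth.contMDiffAt isOpen_univ trivial
  have ha := h.contMDiffAt_form (hX.contMDiffAt hU hx₀)
  have key : ∀ x, q x ∈ V → X x = α x (X x) • ξ x +
      ∑ j, c x j • (hlift G (Y j) x : TangentSpace 𝓘(ℝ, E) x) := by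
    intro x hx
    rw [← sub_eq_zero]
    refine h.eq_zero_of ?_ ?_
    · rw [map_sub, map_add, map_sum]
      simp [h.form_apply, h.form_eq_zero_iff.2 (hlift G (Y _) x).2]
    · rw [map_sub, map_add, map_sum, hc x hx]
      simp [h.mfderiv_hlift, h.mfderiv_xi]
  -- The index `none` carries the vertical part `α(X) ξ`. Its bracket with `ξ` is a multiple of `ξ`,
  -- hence killed by the derivative of `q`, and the lifts commute with `ξ`; only derivatives of the
  -- `c x j` survive.
  let C : Option ι → N → ℝ := fun o x => o.elim (α x (X x)) fun j => c x j
  let L : Option ι → ∀ x : N, TangentSpace 𝓘(ℝ, E) x := fun o x =>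
    o.elim (ξ x) fun j => (hlift G (Y j) x : TangentSpace 𝓘(ℝ, E) x)
  have h1 : X =ᶠ[𝓝 x₀] fun x => ∑ o, C o x • L o x := by
    filter_upwards [h.continuous.continuousAt.eventually (hV.mem_nhds hx₀V)] with x hx
    exact (key x hx).trans (Fintype.sum_option fun o => C o x • L o x).symm
  have h2 := (Filter.EventuallyEq.refl (𝓝 x₀) ξ).mlieBracket_vectorField_eq (I := 𝓘(ℝ, E)) h1
  have h3 := mlieBracket_sum_smul_right (ξ := ξ) (x := x₀) (Finset.univ : Finset (Option ι))
    (c := C) (L := L)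
    (by rintro (_ | j) -; exacts [ha, hcs j]) (by rintro (_ | j) -; exacts [hξ, hL j])
  rw [h2.trans h3, map_sum, Fintype.sum_option]
  have h4 : ∀ j, VectorField.mlieBracket 𝓘(ℝ, E) ξ
      (fun x => (hlift G (Y j) x : TangentSpace 𝓘(ℝ, E) x)) x₀ = 0 := fun j =>
    h.mlieBracket_hlift hV (hY j) hx₀V
  simp [C, L, h.mfderiv_xi, h4, h.mfderiv_hlift]

/-- In a local frame `Y` of `M`, the functions `φ(Y_J) ∘ q` are constant along `ξ`, so the product
rule differentiates only the coefficients of the `X i`. By `mfderiv_mlieBracket` these derivatives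
are the components of the images of `[ξ, X i]`, and the two sides of the Lie derivative cancel. -/
theorem isLieDeriv_pullback {φ : ∀ y : M, TangentSpace 𝓘(ℝ, E') y [⋀^Fin k]→ₗ[ℝ] ℝ}
    (hφ : φ ∈ Omega E' M k) : IsLieDeriv ξ (pullback E' q k φ) 0 := by
  intro U X hU hX x₀ hx₀
  obtain ⟨V, Y, c, hV, hx₀V, hY, hc, hcs⟩ := exists_coeff_along (κ := Fin k)
    (h.contMDiff.contMDiffAt (x := x₀)) (fun i => contMDiffAt_mfderiv_apply h.contMDiff
      ((hX i).contMDiffAt hU hx₀))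
  have hcs' : ∀ i j, ContMDiffAt 𝓘(ℝ, E) 𝓘(ℝ, ℝ) ∞ (fun x => c i x j) x₀ := fun i j =>
    contMDiffAt_pi_space.1 (hcs i) j
  have hg : ∀ J : Fin k → Fin (Module.finrank ℝ E'), ContMDiffAt 𝓘(ℝ, E') 𝓘(ℝ, ℝ) ∞
      (fun y => φ y fun i => Y (J i) y) (q x₀) := fun J =>
    (hφ V (fun i => Y (J i)) hV fun i => hY (J i)).contMDiffAt (hV.mem_nhds hx₀V)
  have h1 : (fun x => pullback E' q k φ x fun i => X i x) =ᶠ[𝓝 x₀]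
      fun x => ∑ J : Fin k → Fin (Module.finrank ℝ E'), (∏ i, c i x (J i)) *
        φ (q x) (fun i => Y (J i) (q x)) := by
    filter_upwards [h.continuous.continuousAt.eventually (hV.mem_nhds hx₀V)] with x hx
    refine Eq.trans ?_ (alternatingMap_sum_smul (φ (q x)) (fun i => c i x) fun j => Y j (q x))
    simp only [← hc x hx]
    rfl
  have hp : ∀ J : Fin k → Fin (Module.finrank ℝ E'), _ := fun J =>
    mvfderiv_fun_prod_apply (Finset.univ : Finset (Fin k)) (f := fun i x => c i x (J i)) (x := x₀)
      (fun i _ => (hcs' i (J i)).mdifferentiableAt (by simp)) (ξ x₀)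
  have hgd : ∀ J : Fin k → Fin (Module.finrank ℝ E'), MDifferentiableAt 𝓘(ℝ, E) 𝓘(ℝ, ℝ)
      (fun x => φ (q x) fun i => Y (J i) (q x)) x₀ := fun J =>
    ((hg J).comp x₀ h.contMDiff.contMDiffAt).mdifferentiableAt (by simp)
  have h2 : mvfderiv 𝓘(ℝ, E) (fun x => pullback E' q k φ x fun i => X i x) x₀ (ξ x₀) =
      ∑ J : Fin k → Fin (Module.finrank ℝ E'),
        (∑ i, mvfderiv 𝓘(ℝ, E) (fun x => c i x (J i)) x₀ (ξ x₀) *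
          ∏ l ∈ Finset.univ.erase i, c l x₀ (J l)) * φ (q x₀) (fun i => Y (J i) (q x₀)) := by
    refine (DFunLike.congr_fun h1.mfderiv_eq (ξ x₀)).trans ?_
    refine (mvfderiv_fun_sum_apply Finset.univ (fun J _ => (hp J).1.mul (hgd J)) (ξ x₀)).2.trans ?_
    refine Finset.sum_congr rfl fun J _ => ?_
    refine (mvfderiv_fun_mul_apply (hp J).1 (hgd J) (ξ x₀)).trans ?_
    rw [h.mvfderiv_comp_xi (hg J), (hp J).2, mul_zero, zero_add]
  have h3 : ∀ i, pullback E' q k φ x₀ (Function.update (fun j => X j x₀) i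
      (VectorField.mlieBracket 𝓘(ℝ, E) ξ (X i) x₀)) =
        ∑ J : Fin k → Fin (Module.finrank ℝ E'),
          (mvfderiv 𝓘(ℝ, E) (fun x => c i x (J i)) x₀ (ξ x₀) *
            ∏ l ∈ Finset.univ.erase i, c l x₀ (J l)) * φ (q x₀) (fun i => Y (J i) (q x₀)) := by
    intro i
    rw [← alternatingMap_update_sum_smul (φ (q x₀)) (fun i => c i x₀) (fun j => Y j (q x₀)) i
      (fun j => mvfderiv 𝓘(ℝ, E) (fun x => c i x j) x₀ (ξ x₀)),
      ← h.mfderiv_mlieBracket hU (hX i) hx₀ hV hx₀V hY (hcs' i) (fun x hx => hc x hx i)]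
    refine congrArg (φ (q x₀)) ?_
    funext l
    rcases eq_or_ne l i with rfl | hl
    · simp
    · simp only [Function.update_of_ne hl]
      exact hc x₀ hx₀V l
  refine Eq.symm (sub_eq_zero.2 ?_)
  refine h2.trans ?_
  rw [Finset.sum_congr rfl fun i _ => h3 i, Finset.sum_comm]
  exact Finset.sum_congr rfl fun J _ => Finset.sum_mul _ _ _

end IsConnection
end Invariance

/-! ### Invariance of wedge products and descent of invariant sections -/

section WedgeForms

variable {E : Type*} [NormedAddCommGroup E] [NormedSpace ℝ E] [FiniteDimensional ℝ E]
  {N : Type*} [TopologicalSpace N] [ChartedSpace E N] [IsManifold 𝓘(ℝ, E) ∞ N]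
  {E' : Type*} [NormedAddCommGroup E'] [NormedSpace ℝ E'] [FiniteDimensional ℝ E']
  {M : Type*} [TopologicalSpace M] [ChartedSpace E' M] [IsManifold 𝓘(ℝ, E') ∞ M]
  {H : ∀ x : N, Submodule ℝ (TangentSpace 𝓘(ℝ, E) x)} {ξ : ∀ x : N, TangentSpace 𝓘(ℝ, E) x}
  {q : N → M} {α : ∀ x : N, TangentSpace 𝓘(ℝ, E) x →ₗ[ℝ] ℝ}
  {G : ∀ x : N, H x ≃ₗ[ℝ] TangentSpace 𝓘(ℝ, E') (q x)} {k : ℕ}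

theorem wedge_apply (α : ∀ x : N, TangentSpace 𝓘(ℝ, E) x →ₗ[ℝ] ℝ)
    (φ : ∀ x : N, TangentSpace 𝓘(ℝ, E) x [⋀^Fin k]→ₗ[ℝ] ℝ) (x : N)
    (v : Fin (k + 1) → TangentSpace 𝓘(ℝ, E) x) :
    wedge α k φ x v =
      ∑ i : Fin (k + 1), (-1 : ℝ) ^ (i : ℕ) * (α x (v i) * φ x (i.removeNth v)) :=
  wedgeOne_apply _ _ _ _

theorem pullback_apply (q : N → M) (φ : ∀ y : M, TangentSpace 𝓘(ℝ, E') y [⋀^Fin k]→ₗ[ℝ] ℝ)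
    (x : N) (v : Fin k → TangentSpace 𝓘(ℝ, E) x) :
    pullback E' q k φ x v = φ (q x) fun i => mfderiv 𝓘(ℝ, E) 𝓘(ℝ, E') q x (v i) := rfl

theorem restrict_apply (ψ : ∀ x : N, TangentSpace 𝓘(ℝ, E) x [⋀^Fin k]→ₗ[ℝ] ℝ)
    (x : N) (v : Fin k → H x) : restrict H k ψ x v = ψ x fun i => v i := rfl

namespace IsConnection

variable (h : IsConnection H ξ q α G)
include h

theorem wedge_mem_omega {φ : ∀ x : N, TangentSpace 𝓘(ℝ, E) x [⋀^Fin k]→ₗ[ℝ] ℝ}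
    (hφ : φ ∈ Omega E N k) : wedge α k φ ∈ Omega E N (k + 1) := by
  intro U X hU hX
  simp only [wedge_apply]
  refine contMDiffOn_finsetSum fun i _ => ?_
  refine ContMDiffOn.mul contMDiffOn_const (ContMDiffOn.mul ?_ ?_)
  · exact h.isContactForm.1 U (X i) hU (hX i)
  · exact hφ U (i.removeNth X) hU fun l => hX _

/-- This is the Leibniz rule combined with `L_ξ α = 0` and `L_ξ φ = 0`. -/
theorem isLieDeriv_wedge {φ : ∀ x : N, TangentSpace 𝓘(ℝ, E) x [⋀^Fin k]→ₗ[ℝ] ℝ}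
    (hφ : φ ∈ Omega E N k) (hL : IsLieDeriv ξ φ 0) : IsLieDeriv ξ (wedge α k φ) 0 := by
  intro U X hU hX x hx
  let B : Fin (k + 1) → TangentSpace 𝓘(ℝ, E) x := fun i =>
    VectorField.mlieBracket 𝓘(ℝ, E) ξ (X i) x
  have hd : ∀ i : Fin (k + 1), mvfderiv 𝓘(ℝ, E) (fun y => φ y (i.removeNth fun j => X j y)) x (ξ x)
      = ∑ l, φ x (Function.update (i.removeNth fun j => X j x) l (B (i.succAbove l))) := fun i =>
    (sub_eq_zero.1 (hL U (i.removeNth X) hU (fun l => hX _) x hx).symm)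
  have h1 : ∀ i : Fin (k + 1), MDifferentiableAt 𝓘(ℝ, E) 𝓘(ℝ, ℝ) (fun y => α y (X i y)) x :=
    fun i => (h.contMDiffAt_form ((hX i).contMDiffAt hU hx)).mdifferentiableAt (by simp)
  have h2 : ∀ i : Fin (k + 1), MDifferentiableAt 𝓘(ℝ, E) 𝓘(ℝ, ℝ)
      (fun y => φ y (i.removeNth fun j => X j y)) x := fun i =>
    ((hφ U (i.removeNth X) hU fun l => hX _).contMDiffAt
      (hU.mem_nhds hx)).mdifferentiableAt (by simp)
  have h3 : mvfderiv 𝓘(ℝ, E) (fun y => wedge α k φ y fun i => X i y) x (ξ x) =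
      ∑ i : Fin (k + 1), (-1 : ℝ) ^ (i : ℕ) * (α x (X i x) *
        ∑ l, φ x (Function.update (i.removeNth fun j => X j x) l (B (i.succAbove l))) +
          α x (B i) * φ x (i.removeNth fun j => X j x)) := by
    simp only [wedge_apply]
    refine (mvfderiv_fun_sum_apply Finset.univ (fun i _ =>
      mdifferentiableAt_const.mul ((h1 i).mul (h2 i))) (ξ x)).2.trans ?_
    refine Finset.sum_congr rfl fun i _ => ?_
    refine (mvfderiv_fun_mul_apply mdifferentiableAt_const ((h1 i).mul (h2 i)) (ξ x)).trans ?_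
    rw [mvfderiv_const]
    refine (congrArg₂ (· + ·) rfl (zero_mul _)).trans ?_
    rw [add_zero]
    congr 1
    refine (mvfderiv_fun_mul_apply (h1 i) (h2 i) (ξ x)).trans ?_
    rw [hd i, h.mvfderiv_form hU (hX i) hx]
  have h4 : ∑ m, wedge α k φ x (Function.update (fun j => X j x) m (B m)) =
      ∑ i : Fin (k + 1), (-1 : ℝ) ^ (i : ℕ) * (α x (X i x) *
        ∑ l, φ x (Function.update (i.removeNth fun j => X j x) l (B (i.succAbove l))) +
          α x (B i) * φ x (i.removeNth fun j => X j x)) := by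
    simp only [wedge_apply]
    rw [Finset.sum_comm]
    refine Finset.sum_congr rfl fun i _ => ?_
    -- In summand `i` of the wedge product, the bracket sits either in the slot `i` taken by `α` or
    -- in a slot `i.succAbove l` of `φ`.
    rw [← Finset.mul_sum, Fin.sum_univ_succAbove _ i, Function.update_self, Fin.removeNth_update,
      add_comm (α x (B i) * _), Finset.mul_sum]
    congr 2
    refine Finset.sum_congr rfl fun l _ => ?_
    rw [Function.update_of_ne (Fin.succAbove_ne i l).symm, Fin.removeNth_update_succAbove]
  exact Eq.symm (sub_eq_zero.2 (h3.trans h4.symm))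

theorem mem_ker_mfderiv_iff {x : N} {v : TangentSpace 𝓘(ℝ, E) x} :
    mfderiv 𝓘(ℝ, E) 𝓘(ℝ, E') q x v = 0 ↔ ∃ c : ℝ, c • ξ x = v := by
  rw [← Submodule.mem_span_singleton, ← h.isQuotient.ker_eq]
  rfl

/-- Invariant sections of `Λᵏ H*` descend. -/
theorem exists_descent {σ : ∀ x : N, H x [⋀^Fin k]→ₗ[ℝ] ℝ} (hσ : σ ∈ GammaH H k)
    (hinv : ∀ (V : Set M) (Y : Fin k → ∀ y : M, TangentSpace 𝓘(ℝ, E') y), IsOpen V →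
      (∀ i, SmoothVF V (Y i)) → ∀ x, q x ∈ V →
        mvfderiv 𝓘(ℝ, E) (fun z => σ z fun i => hlift G (Y i) z) x (ξ x) = 0) :
    ∃ φ ∈ Omega E' M k, restrict H k (pullback E' q k φ) = σ := by
  let τ : ∀ x : N, TangentSpace 𝓘(ℝ, E') (q x) [⋀^Fin k]→ₗ[ℝ] ℝ := fun x =>
    (σ x).compLinearMap (G x).symm.toLinearMap
  -- Values on horizontal lifts are annihilated by `ξ`, hence by every vertical vector, and so are
  -- constant on the connected fibers.
  have hτ : ∀ (V : Set M) (Y : Fin k → ∀ y : M, TangentSpace 𝓘(ℝ, E') y), IsOpen V →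
      (∀ i, SmoothVF V (Y i)) → ∀ x x', q x ∈ V → q x = q x' →
        (τ x fun i => Y i (q x)) = τ x' fun i => Y i (q x') := by
    intro V Y hV hY x x' hx hxx'
    refine eq_of_vertical_derivative_zero (f := fun z => σ z fun i => hlift G (Y i) z)
      h.isQuotient.submersion (h.isQuotient.connected (q x)).isPreconnected
      (hV.preimage h.continuous) (fun z (hz : q z = q x) => Set.mem_preimage.2 (hz.symm ▸ hx))
      (hσ _ _ (hV.preimage h.continuous) fun i => h.smoothSec_hlift hV (hY i)) ?_ rfl hxx'.symm
    intro z hz v hv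
    obtain ⟨c, rfl⟩ := h.mem_ker_mfderiv_iff.1 hv
    rw [map_smul, hinv V Y hV hY z hz, smul_zero]
  choose r hr using h.isQuotient.surjective
  let φ : ∀ y : M, TangentSpace 𝓘(ℝ, E') y [⋀^Fin k]→ₗ[ℝ] ℝ := fun y => hr y ▸ τ (r y)
  -- The chosen point over `y` is immaterial: every tuple of tangent vectors at `y` extends to local
  -- fields, for which `hτ` compares the points of the fiber.
  have hφr : ∀ (y : M) (x : N) (hx : q x = y), (hx ▸ τ x : TangentSpace 𝓘(ℝ, E') y [⋀^Fin k]→ₗ[ℝ] ℝ)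
      = φ y := by
    intro y x hx
    ext u
    obtain ⟨V, Y, hV, hyV, hY, hYu⟩ := exists_smoothVF_extend (E := E') y u
    obtain rfl : u = fun i => Y i y := by funext i; exact (hYu i).symm
    have h1 : ∀ (x : N) (hx : q x = y),
        (hx ▸ τ x : TangentSpace 𝓘(ℝ, E') y [⋀^Fin k]→ₗ[ℝ] ℝ) (fun i => Y i y) =
          τ x fun i => Y i (q x) := by
      rintro x rfl; rfl
    refine (h1 x hx).trans (Eq.trans ?_ (h1 (r y) (hr y)).symm)
    exact hτ V Y hV hY x (r y) (hx ▸ hyV) (hx.trans (hr y).symm)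
  have hφ : ∀ x, φ (q x) = τ x := fun x => (hφr (q x) x rfl).symm
  refine ⟨φ, ?_, ?_⟩
  · intro V Y hV hY y hy
    obtain ⟨x, rfl⟩ := h.isQuotient.surjective y
    -- Along a local section `s`, the function `φ(Y)` is the smooth function `σ(lifts of Y)`
    -- composed with `s`.
    obtain ⟨W, s, hW, hxW, hs, hsx, hqs⟩ := exists_local_section h.isQuotient.submersion x
    have h1 : ContMDiffAt 𝓘(ℝ, E) 𝓘(ℝ, ℝ) ∞ (fun z => σ z fun i => hlift G (Y i) z) (s (q x)) :=
      (hσ _ _ (hV.preimage h.continuous) fun i => h.smoothSec_hlift hV (hY i)).contMDiffAt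
        ((hV.preimage h.continuous).mem_nhds (by rw [hsx]; exact hy))
    have h2 := h1.comp (q x) (hs.contMDiffAt (hW.mem_nhds hxW))
    refine ContMDiffAt.contMDiffWithinAt (h2.congr_of_eventuallyEq ?_)
    filter_upwards [hW.mem_nhds hxW] with y hy
    obtain ⟨x', rfl⟩ : ∃ x', q x' = y := ⟨s y, hqs y hy⟩
    have h3 : ∀ y' (e : q x' = y'), (φ (q x') fun i => Y i (q x')) = φ y' fun i => Y i y' := by
      rintro _ rfl; rfl
    refine (h3 _ (hqs _ hy).symm).trans ?_
    rw [hφ]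
    rfl
  · funext x
    ext v
    rw [restrict_apply, pullback_apply, hφ]
    refine congrArg (σ x) ?_
    funext i
    exact (G x).symm_apply_eq.2 (h.lift_apply x (v i)).symm

theorem restrict_pullback_apply (φ : ∀ y : M, TangentSpace 𝓘(ℝ, E') y [⋀^Fin k]→ₗ[ℝ] ℝ) (x : N) :
    restrict H k (pullback E' q k φ) x = (φ (q x)).compLinearMap (G x).toLinearMap := by
  ext v
  rw [restrict_apply, pullback_apply]
  refine congrArg (φ (q x)) ?_
  funext i
  exact (h.lift_apply x (v i)).symm

theorem restrict_pullback_injective :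
    Function.Injective (restrict H k ∘ₗ pullback E' q k) := by
  intro φ φ' hφ
  funext y
  obtain ⟨x, rfl⟩ := h.isQuotient.surjective y
  have h1 := congrFun hφ x
  simp only [LinearMap.comp_apply] at h1
  rw [h.restrict_pullback_apply, h.restrict_pullback_apply] at h1
  ext u
  have h2 := DFunLike.congr_fun h1 fun i => (G x).symm (u i)
  simpa using h2

/-- `Ωᵏ(M)` corresponds to the invariant sections of `Λᵏ H*`. -/
theorem bijOn_restrict_pullback (k : ℕ) :
    Set.BijOn (restrict H k ∘ₗ pullback E' q k) (Omega E' M k)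
      {σ | σ ∈ GammaH H k ∧ IsLieDerivH H ξ σ 0} := by
  refine ⟨fun φ hφ => ⟨restrict_mem_gammaH (pullback_mem_omega hφ h.contMDiff),
    (h.isLieDeriv_pullback hφ).restrict⟩, h.restrict_pullback_injective.injOn, ?_⟩
  rintro σ ⟨hσ, hL⟩
  refine h.exists_descent hσ ?_
  intro V Y hV hY x hx
  -- All brackets of `ξ` with lifts vanish, so on lifts the Lie derivative is just the derivative of
  -- the function along `ξ`.
  have h1 := hL _ (fun i => hlift G (Y i)) (hV.preimage h.continuous)
    (fun i => h.smoothSec_hlift hV (hY i)) x hx 0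
    (fun i => (h.mlieBracket_hlift hV (hY i) hx).symm)
  have h2 : ∀ i, σ x (Function.update (fun j => hlift G (Y j) x) i 0) = 0 := fun i =>
    (σ x).map_update_zero _ i
  refine (sub_zero _).symm.trans (Eq.trans ?_ h1.symm)
  congr 1
  exact (Finset.sum_eq_zero fun i _ => h2 i).symm

end IsConnection
end WedgeForms

/-! ### Alternating forms on a space with a complement of a line -/

section AlternatingExt

variable {V : Type*} [AddCommGroup V] [Module ℝ V] {k : ℕ}

/-- In the multilinear expansion, every term but `η w` contains a multiple of `u` as an entry. -/
theorem alternatingMap_add_smul (η : V [⋀^Fin k]→ₗ[ℝ] ℝ) {u : V}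
    (hη : ∀ v i, v i = u → η v = 0) (w : Fin k → V) (c : Fin k → ℝ) :
    η (fun i => w i + c i • u) = η w := by
  classical
  refine (η.toMultilinearMap.map_add_univ w fun i => c i • u).trans ?_
  rw [Finset.sum_eq_single Finset.univ]
  · rw [Finset.piecewise_univ]; rfl
  · intro s _ hs
    obtain ⟨i, hi⟩ : ∃ i, i ∉ s := by
      by_contra! h
      exact hs (Finset.eq_univ_iff_forall.2 h)
    have h1 : s.piecewise w (fun i => c i • u) =
        Function.update (s.piecewise w fun i => c i • u) i (c i • u) := by
      rw [eq_comm, Function.update_eq_self_iff, Finset.piecewise_eq_of_notMem _ _ _ hi]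
    rw [h1, MultilinearMap.map_update_smul]
    have h2 := hη (Function.update (s.piecewise w fun i => c i • u) i u) i (by simp)
    exact (congrArg (c i • ·) h2).trans (smul_zero _)
  · simp

/-- Alternating forms on `V = P ⊕ ℝ u` are determined by their restriction to `P` and by the
restriction to `P` of their contraction with `u`. -/
theorem alternatingMap_ext_of_complement {P : Submodule ℝ V} {u : V} {a : V → ℝ}
    (ha : ∀ v, v - a v • u ∈ P) {ψ ψ' : V [⋀^Fin (k + 1)]→ₗ[ℝ] ℝ}
    (h1 : ∀ v : Fin (k + 1) → P, ψ (fun i => v i) = ψ' fun i => v i)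
    (h2 : ∀ v : Fin k → P, ψ (Matrix.vecCons u fun i => v i) =
      ψ' (Matrix.vecCons u fun i => v i)) : ψ = ψ' := by
  rw [← sub_eq_zero]
  set θ := ψ - ψ'
  have hsplit : ∀ {m : ℕ} (v : Fin m → V), v = fun i => (v i - a (v i) • u) + a (v i) • u :=
    fun v => by funext i; simp
  have h3 : ∀ v : Fin k → V, θ (Matrix.vecCons u v) = 0 := by
    intro v
    have h4 := alternatingMap_add_smul (θ.curryLeft u) (u := u) (fun v i hi => by
      rw [AlternatingMap.curryLeft_apply_apply]
      exact θ.map_eq_zero_of_eq _ (i := 0) (j := i.succ) (by simp [hi]) (Fin.succ_ne_zero i).symm)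
      (fun i => v i - a (v i) • u) fun i => a (v i)
    rw [← hsplit v] at h4
    rw [← AlternatingMap.curryLeft_apply_apply, h4, AlternatingMap.curryLeft_apply_apply]
    exact sub_eq_zero.2 (h2 fun i => ⟨v i - a (v i) • u, ha _⟩)
  ext v
  rw [hsplit v, alternatingMap_add_smul θ]
  · exact sub_eq_zero.2 (h1 fun i => ⟨v i - a (v i) • u, ha _⟩)
  · intro v i hi
    rcases eq_or_ne i 0 with rfl | hi0
    · rw [← Fin.cons_self_tail v, hi]
      exact h3 _
    -- A swap moves the entry `u` to the front, at the cost of a sign.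
    · have h5 := θ.map_swap v hi0
      have h6 : v ∘ Equiv.swap i 0 = Matrix.vecCons u (Fin.tail (v ∘ Equiv.swap i 0)) := by
        refine (Fin.cons_self_tail (v ∘ Equiv.swap i 0)).symm.trans ?_
        rw [Function.comp_apply, Equiv.swap_apply_right, hi]
        rfl
      rw [h6, h3] at h5
      exact neg_eq_zero.1 h5.symm

end AlternatingExt

/-! ### The bijections with invariant sections and forms -/

section Isomorphisms

variable {E : Type*} [NormedAddCommGroup E] [NormedSpace ℝ E] [FiniteDimensional ℝ E]
  {N : Type*} [TopologicalSpace N] [ChartedSpace E N] [IsManifold 𝓘(ℝ, E) ∞ N]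
  {E' : Type*} [NormedAddCommGroup E'] [NormedSpace ℝ E'] [FiniteDimensional ℝ E']
  {M : Type*} [TopologicalSpace M] [ChartedSpace E' M] [IsManifold 𝓘(ℝ, E') ∞ M]
  {H : ∀ x : N, Submodule ℝ (TangentSpace 𝓘(ℝ, E) x)} {ξ : ∀ x : N, TangentSpace 𝓘(ℝ, E) x}
  {q : N → M} {α : ∀ x : N, TangentSpace 𝓘(ℝ, E) x →ₗ[ℝ] ℝ}
  {G : ∀ x : N, H x ≃ₗ[ℝ] TangentSpace 𝓘(ℝ, E') (q x)} {k : ℕ}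

theorem IsLieDeriv.add_zero_right {ψ ψ' : ∀ x : N, TangentSpace 𝓘(ℝ, E) x [⋀^Fin k]→ₗ[ℝ] ℝ}
    (hL : IsLieDeriv ξ ψ 0) (hψ : ψ ∈ Omega E N k) (hψ' : ψ' ∈ Omega E N k)
    (hL' : IsLieDeriv ξ ψ' 0) : IsLieDeriv ξ (ψ + ψ') 0 := by
  intro U X hU hX x hx
  have h1 := hL U X hU hX x hx
  have h2 := hL' U X hU hX x hx
  have h3 := DFunLike.congr_fun (mvfderiv_add
    (((hψ U X hU hX).contMDiffAt (hU.mem_nhds hx)).mdifferentiableAt (by simp))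
    (((hψ' U X hU hX).contMDiffAt (hU.mem_nhds hx)).mdifferentiableAt (by simp))) (ξ x)
  refine Eq.symm ((congrArg₂ (· - ·) h3 (Finset.sum_add_distrib)).trans ?_)
  refine (add_sub_add_comm _ _ _ _).trans ?_
  exact (congrArg₂ (· + ·) h1.symm h2.symm).trans (add_zero _)

namespace IsConnection

variable (h : IsConnection H ξ q α G)
include h

theorem form_apply_mem {x : N} (v : H x) : α x v = 0 := h.form_eq_zero_iff.2 v.2

theorem ext_of_restrict {ψ ψ' : ∀ x : N, TangentSpace 𝓘(ℝ, E) x [⋀^Fin (k + 1)]→ₗ[ℝ] ℝ}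
    (h1 : restrict H (k + 1) ψ = restrict H (k + 1) ψ')
    (h2 : ∀ x (v : Fin k → H x), ψ x (Matrix.vecCons (ξ x) fun i => v i) =
      ψ' x (Matrix.vecCons (ξ x) fun i => v i)) : ψ = ψ' := by
  funext x
  exact alternatingMap_ext_of_complement (fun v => h.sub_smul_mem x v)
    (fun v => DFunLike.congr_fun (congrFun h1 x) v) (h2 x)

theorem restrict_wedge (φ : ∀ x : N, TangentSpace 𝓘(ℝ, E) x [⋀^Fin k]→ₗ[ℝ] ℝ) :
    restrict H (k + 1) (wedge α k φ) = 0 := by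
  funext x
  ext v
  rw [restrict_apply, wedge_apply]
  exact Finset.sum_eq_zero fun i _ => by rw [h.form_apply_mem, zero_mul, mul_zero]

/-- All entries after the first are horizontal, so only the summand in which `α` takes `u` survives.
-/
theorem wedge_vecCons (φ : ∀ x : N, TangentSpace 𝓘(ℝ, E) x [⋀^Fin k]→ₗ[ℝ] ℝ) (x : N)
    (u : TangentSpace 𝓘(ℝ, E) x) (v : Fin k → H x) :
    wedge α k φ x (Matrix.vecCons u fun i => v i) = α x u * φ x fun i => v i := by
  rw [wedge_apply, Fin.sum_univ_succ]
  refine (congrArg₂ (· + ·) ?_ (Finset.sum_eq_zero fun i _ => ?_)).trans (add_zero _)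
  · rw [Fin.val_zero, pow_zero, one_mul]
    rfl
  · rw [Matrix.cons_val_succ, h.form_apply_mem, zero_mul, mul_zero]

theorem pullback_vecCons (φ : ∀ y : M, TangentSpace 𝓘(ℝ, E') y [⋀^Fin (k + 1)]→ₗ[ℝ] ℝ) (x : N)
    (v : Fin k → TangentSpace 𝓘(ℝ, E) x) :
    pullback E' q (k + 1) φ x (Matrix.vecCons (ξ x) v) = 0 := by
  rw [pullback_apply]
  exact (φ (q x)).map_coord_zero 0 (h.mfderiv_xi x)

/-- The contraction of an invariant form with `ξ` descends. -/
theorem exists_contract {ψ : ∀ x : N, TangentSpace 𝓘(ℝ, E) x [⋀^Fin (k + 1)]→ₗ[ℝ] ℝ}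
    (hψ : ψ ∈ Omega E N (k + 1)) (hL : IsLieDeriv ξ ψ 0) :
    ∃ φ ∈ Omega E' M k, ∀ x (v : Fin k → H x),
      ψ x (Matrix.vecCons (ξ x) fun i => v i) = wedge α k (pullback E' q k φ) x
        (Matrix.vecCons (ξ x) fun i => v i) := by
  -- The field `ξ` is put in front. As `[ξ, ξ] = 0` and lifts commute with `ξ`, invariance of `ψ`
  -- makes `ψ(ξ, lifts)` constant along `ξ`.
  let Xc : (Fin k → ∀ x : N, H x) → Fin (k + 1) → ∀ x : N, TangentSpace 𝓘(ℝ, E) x := fun X =>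
    Fin.cons ξ fun i x => X i x
  have hXc : ∀ X x, (fun i => Xc X i x) = Matrix.vecCons (ξ x) fun i => (X i x : _) := by
    intro X x
    funext i
    cases i using Fin.cases <;> rfl
  have hXs : ∀ {U : Set N} {X : Fin k → ∀ x : N, H x}, (∀ i, SmoothSec H U (X i)) →
      ∀ i, SmoothVF U (Xc X i) := by
    intro U X hX i
    cases i using Fin.cases with
    | zero => exact ContMDiffOn.mono h.isTransversalAut.smooth (Set.subset_univ U)
    | succ i => exact hX i
  suffices h1 : ∃ φ ∈ Omega E' M k, restrict H k (pullback E' q k φ) =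
      restrict H k fun x => (ψ x).curryLeft (ξ x) by
    obtain ⟨φ, hφ, hr⟩ := h1
    refine ⟨φ, hφ, fun x v => ?_⟩
    rw [h.wedge_vecCons, h.form_apply, one_mul]
    exact (DFunLike.congr_fun (congrFun hr x) v).symm
  refine h.exists_descent ?_ ?_
  · intro U X hU hX
    have h1 := hψ U (Xc X) hU (hXs hX)
    simp only [hXc] at h1
    exact h1
  · intro V Y hV hY x hx
    have h1 := hL _ (Xc fun i => hlift G (Y i)) (hV.preimage h.continuous)
      (hXs fun i => h.smoothSec_hlift hV (hY i)) x hx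
    simp only [hXc] at h1
    refine Eq.trans ?_ h1.symm
    refine (sub_zero _).symm.trans (congrArg₂ _ rfl (Finset.sum_eq_zero fun i _ => ?_).symm)
    have h2 : VectorField.mlieBracket 𝓘(ℝ, E) ξ (Xc (fun i => hlift G (Y i)) i) x = 0 := by
      cases i using Fin.cases with
      | zero => exact congrFun VectorField.mlieBracket_self x
      | succ i => exact h.mlieBracket_hlift hV (hY i) hx
    rw [h2]
    exact (ψ x).map_update_zero _ i

theorem wedge_pullback_injective : Function.Injective (wedge α k ∘ₗ pullback E' q k) := by
  intro φ φ' hφ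
  refine h.restrict_pullback_injective ?_
  funext x
  ext v
  have h1 := DFunLike.congr_fun (congrFun hφ x) (Matrix.vecCons (ξ x) fun i => (v i : _))
  simp only [LinearMap.comp_apply] at h1
  rw [h.wedge_vecCons, h.wedge_vecCons, h.form_apply, one_mul, one_mul] at h1
  exact h1

/-- `Ωᵏ(M)` corresponds to the invariant sections of `Λᵏ H* ⊗ Q*`. -/
theorem bijOn_wedge_pullback (k : ℕ) :
    Set.BijOn (wedge α k ∘ₗ pullback E' q k) (Omega E' M k)
      {ψ | ψ ∈ GammaHQ H k ∧ IsLieDeriv ξ ψ 0} := by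
  refine ⟨fun φ hφ => ?_, h.wedge_pullback_injective.injOn, ?_⟩
  · have h1 := pullback_mem_omega hφ h.contMDiff
    exact ⟨⟨h.wedge_mem_omega h1, h.restrict_wedge _⟩,
      h.isLieDeriv_wedge h1 (h.isLieDeriv_pullback hφ)⟩
  · rintro ψ ⟨⟨hψ, hr⟩, hL⟩
    obtain ⟨φ, hφ, hc⟩ := h.exists_contract hψ hL
    refine ⟨φ, hφ, h.ext_of_restrict ?_ fun x v => (hc x v).symm⟩
    exact (h.restrict_wedge _).trans (LinearMap.mem_ker.1 hr).symm

/-- Degree zero is separate since `Ω⁻¹(M) = 0` leaves no second summand. A 0-form has only the empty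
tuple to evaluate on, so restriction to `H` loses nothing. -/
theorem bijOn_pullback_zero :
    Set.BijOn (pullback E' q 0) (Omega E' M 0) {ψ | ψ ∈ Omega E N 0 ∧ IsLieDeriv ξ ψ 0} := by
  have hinj : Function.Injective (restrict H 0) := by
    intro ψ ψ' hr
    funext x
    ext v
    have h1 := DFunLike.congr_fun (congrFun hr x) ![]
    rw [restrict_apply, restrict_apply] at h1
    convert h1
  refine ⟨fun φ hφ => ⟨pullback_mem_omega hφ h.contMDiff, h.isLieDeriv_pullback hφ⟩,
    fun φ _ φ' _ hφ => h.restrict_pullback_injective (congrArg (restrict H 0) hφ), ?_⟩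
  rintro ψ ⟨hψ, hL⟩
  obtain ⟨φ, hφ, hr⟩ := (h.bijOn_restrict_pullback 0).surjOn ⟨restrict_mem_gammaH hψ, hL.restrict⟩
  exact ⟨φ, hφ, hinj hr⟩

/-- Invariant forms on `N` in terms of forms on `M`. -/
theorem bijOn_coprod (k : ℕ) :
    Set.BijOn ((pullback E' q (k + 1)).coprod (wedge α k ∘ₗ pullback E' q k))
      ((Omega E' M (k + 1)).prod (Omega E' M k))
      {ψ | ψ ∈ Omega E N (k + 1) ∧ IsLieDeriv ξ ψ 0} := by
  -- The two components are separated: restriction to `H` sees only the first form, contraction with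
  -- `ξ` only the second.
  have hr : ∀ p, restrict H (k + 1) ((pullback E' q (k + 1)).coprod (wedge α k ∘ₗ pullback E' q k) p)
      = restrict H (k + 1) (pullback E' q (k + 1) p.1) := fun p => by
    rw [LinearMap.coprod_apply, map_add, LinearMap.comp_apply, h.restrict_wedge, add_zero]
  have hc : ∀ p x v, (pullback E' q (k + 1)).coprod (wedge α k ∘ₗ pullback E' q k) p x
      (Matrix.vecCons (ξ x) v) = wedge α k (pullback E' q k p.2) x (Matrix.vecCons (ξ x) v) :=
    fun p x v => (congrArg₂ (· + ·) (h.pullback_vecCons p.1 x v) rfl).trans (zero_add _)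
  refine ⟨?_, ?_, ?_⟩
  · rintro ⟨φ₁, φ₂⟩ ⟨h1, h2⟩
    have h3 := pullback_mem_omega h2 h.contMDiff
    have h4 := h.wedge_mem_omega h3
    have h5 := h.isLieDeriv_pullback h1
    have h6 := h.isLieDeriv_wedge h3 (h.isLieDeriv_pullback h2)
    have h7 := pullback_mem_omega h1 h.contMDiff
    refine ⟨add_mem h7 h4, ?_⟩
    exact h5.add_zero_right h7 h4 h6
  · rintro ⟨φ₁, φ₂⟩ - ⟨φ₁', φ₂'⟩ - he
    refine Prod.ext ?_ ?_
    · refine h.restrict_pullback_injective ?_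
      exact (hr (φ₁, φ₂)).symm.trans ((congrArg (restrict H (k + 1)) he).trans (hr (φ₁', φ₂')))
    · refine h.wedge_pullback_injective (h.ext_of_restrict ?_ fun x v => ?_)
      · exact (h.restrict_wedge _).trans (h.restrict_wedge _).symm
      · exact (hc (φ₁, φ₂) x _).symm.trans ((DFunLike.congr_fun (congrFun he x) _).trans
          (hc (φ₁', φ₂') x _))
  · rintro ψ ⟨hψ, hL⟩
    obtain ⟨φ₂, hφ₂, h2⟩ := h.exists_contract hψ hL
    obtain ⟨φ₁, hφ₁, h1⟩ := (h.bijOn_restrict_pullback (k + 1)).surjOn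
      ⟨restrict_mem_gammaH hψ, hL.restrict⟩
    refine ⟨(φ₁, φ₂), ⟨hφ₁, hφ₂⟩, h.ext_of_restrict ((hr (φ₁, φ₂)).trans h1) fun x v => ?_⟩
    exact (hc (φ₁, φ₂) x _).trans (h2 x v).symm

/-! ### Tracefree refinements of the bijections -/

section Primitive

variable {n : ℕ}
  (hprim : ∀ (x : N) (θ : TangentSpace 𝓘(ℝ, E') (q x) [⋀^Fin k]→ₗ[ℝ] ℝ),
    θ ∈ primitive n (csForm E' H q (q x)) k ↔
      θ.compLinearMap (G x).toLinearMap ∈ primitive n (leviBracket H x) k)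
include hprim

/-- The tracefree condition is pointwise, `hprim` transfers it from `q x` to `x`, and every point of
`M` is some `q x`. -/
theorem mem_omega0_iff {φ : ∀ y : M, TangentSpace 𝓘(ℝ, E') y [⋀^Fin k]→ₗ[ℝ] ℝ} :
    φ ∈ Omega0 E' H q n k ↔ φ ∈ Omega E' M k ∧
      ∀ x, restrict H k (pullback E' q k φ) x ∈ primitive n (leviBracket H x) k := by
  refine and_congr Iff.rfl ⟨fun h1 x => ?_, fun h1 y _ => ?_⟩
  · rw [h.restrict_pullback_apply, ← hprim]
    exact h1 (q x) trivial
  · obtain ⟨x, rfl⟩ := h.isQuotient.surjective y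
    refine (hprim x (φ (q x))).2 ?_
    rw [← h.restrict_pullback_apply]
    exact h1 x

theorem bijOn_restrict_pullback_primitive :
    Set.BijOn (restrict H k ∘ₗ pullback E' q k) (Omega0 E' H q n k)
      {σ | σ ∈ GammaH0 H n k ∧ IsLieDerivH H ξ σ 0} := by
  refine ⟨fun φ hφ => ?_, h.restrict_pullback_injective.injOn, ?_⟩
  · obtain ⟨h1, h2⟩ := (h.mem_omega0_iff hprim).1 hφ
    have h3 := (h.bijOn_restrict_pullback k).mapsTo h1
    exact ⟨⟨h3.1, fun x _ => h2 x⟩, h3.2⟩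
  · rintro σ ⟨⟨hσ, hp⟩, hL⟩
    obtain ⟨φ, hφ, rfl⟩ := (h.bijOn_restrict_pullback k).surjOn ⟨hσ, hL⟩
    exact ⟨φ, (h.mem_omega0_iff hprim).2 ⟨hφ, fun x => hp x trivial⟩, rfl⟩

theorem bijOn_wedge_pullback_primitive :
    Set.BijOn (wedge α k ∘ₗ pullback E' q k) (Omega0 E' H q n k)
      {ψ | ψ ∈ GammaHQ0 H n k ∧ IsLieDeriv ξ ψ 0} := by
  -- The contraction with any `u` is a multiple of one form on `H_x`, so testing `u = ξ x` decides
  -- the condition for all `u`.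
  have hcurry : ∀ (φ : ∀ y : M, TangentSpace 𝓘(ℝ, E') y [⋀^Fin k]→ₗ[ℝ] ℝ) (x : N)
      (u : TangentSpace 𝓘(ℝ, E) x),
      (((wedge α k (pullback E' q k φ)) x).curryLeft u).compLinearMap (H x).subtype =
        α x u • restrict H k (pullback E' q k φ) x := by
    intro φ x u
    ext v
    exact h.wedge_vecCons (pullback E' q k φ) x u v
  refine ⟨fun φ hφ => ?_, h.wedge_pullback_injective.injOn, ?_⟩
  · obtain ⟨h1, h2⟩ := (h.mem_omega0_iff hprim).1 hφ
    have h3 := (h.bijOn_wedge_pullback k).mapsTo h1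
    refine ⟨⟨h3.1, fun x u => ?_⟩, h3.2⟩
    refine (hcurry φ x u).symm ▸ Submodule.smul_mem _ _ (h2 x)
  · rintro ψ ⟨⟨hψ, hp⟩, hL⟩
    obtain ⟨φ, hφ, rfl⟩ := (h.bijOn_wedge_pullback k).surjOn ⟨hψ, hL⟩
    refine ⟨φ, (h.mem_omega0_iff hprim).2 ⟨hφ, fun x => ?_⟩, rfl⟩
    have h1 := hp x (ξ x)
    have h2 := hcurry φ x (ξ x)
    rw [h.form_apply, one_smul] at h2
    exact h2 ▸ h1

end Primitive
end IsConnection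
end Isomorphisms

/-! ### Naturality of the tracefree parts -/

section Naturality

variable {V W V' W' : Type*} [AddCommGroup V] [Module ℝ V] [AddCommGroup W] [Module ℝ W]
  [AddCommGroup V'] [Module ℝ V'] [AddCommGroup W'] [Module ℝ W']

theorem domCoprod_compLinearMap {ιa ιb : Type*} [Fintype ιa] [Fintype ιb] [DecidableEq ιa]
    [DecidableEq ιb] (a : V [⋀^ιa]→ₗ[ℝ] W) (b : V [⋀^ιb]→ₗ[ℝ] W') (g : V' →ₗ[ℝ] V) :
    (a.domCoprod b).compLinearMap g = (a.compLinearMap g).domCoprod (b.compLinearMap g) := by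
  ext v
  change (AlternatingMap.domCoprod a b) (g ∘ v) = _
  simp only [AlternatingMap.domCoprod_apply, sum_apply]
  refine Finset.sum_congr rfl fun σ _ => ?_
  induction σ using Quotient.inductionOn' with | h σ => ?_
  rfl

theorem domCoprod_compAlternatingMap_left {ιa ιb : Type*} [Fintype ιa] [Fintype ιb] [DecidableEq ιa]
    [DecidableEq ιb] (a : V [⋀^ιa]→ₗ[ℝ] W) (b : V [⋀^ιb]→ₗ[ℝ] V') (T : W →ₗ[ℝ] W') :
    (T.compAlternatingMap a).domCoprod b =
      (TensorProduct.map T LinearMap.id).compAlternatingMap (a.domCoprod b) := by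
  ext v
  simp only [AlternatingMap.domCoprod_apply, sum_apply,
    LinearMap.compAlternatingMap_apply, map_sum]
  refine Finset.sum_congr rfl fun σ _ => ?_
  induction σ using Quotient.inductionOn' with | h σ => ?_
  refine Eq.trans ?_ (LinearMap.map_smul_of_tower _ _ _).symm
  rfl

variable {B : V [⋀^Fin 2]→ₗ[ℝ] W} {B' : V' [⋀^Fin 2]→ₗ[ℝ] W'} {g : V ≃ₗ[ℝ] V'} {T : W ≃ₗ[ℝ] W'}
  (hB : ∀ u v, B' ![g u, g v] = T (B ![u, v])) {k : ℕ}
include hB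

theorem compLinearMap_eq_compAlternatingMap :
    B'.compLinearMap g.toLinearMap = T.toLinearMap.compAlternatingMap B := by
  ext v
  have h1 : v = ![v 0, v 1] := by
    funext i; fin_cases i <;> rfl
  have h2 : (fun i => g (v i)) = ![g (v 0), g (v 1)] := by
    funext i; fin_cases i <;> rfl
  refine (congrArg B' h2).trans ((hB _ _).trans ?_)
  rw [← h1]
  rfl

/-- Pulled back along `g`, the wedge product with `B'` becomes the one with `B` followed by `T ⊗
id`; both maps are invertible. -/
theorem wedgeTwo_eq_zero_iff (θ : V' [⋀^Fin k]→ₗ[ℝ] ℝ) :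
    wedgeTwo B' k θ = 0 ↔ wedgeTwo B k (θ.compLinearMap g.toLinearMap) = 0 := by
  have h1 : (wedgeTwo B' k θ).compLinearMap g.toLinearMap =
      (TensorProduct.congr T (LinearEquiv.refl ℝ ℝ)).toLinearMap.compAlternatingMap
        (wedgeTwo B k (θ.compLinearMap g.toLinearMap)) := by
    refine (domCoprod_compLinearMap B' θ g.toLinearMap).trans ?_
    rw [compLinearMap_eq_compAlternatingMap hB]
    exact domCoprod_compAlternatingMap_left _ _ _
  constructor
  · intro h2
    rw [h2] at h1
    ext v
    refine (TensorProduct.congr T (LinearEquiv.refl ℝ ℝ)).map_eq_zero_iff.1 ?_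
    exact (DFunLike.congr_fun h1 v).symm
  · intro h2
    rw [h2] at h1
    ext v
    have h3 := DFunLike.congr_fun h1 fun i => g.symm (v i)
    refine Eq.trans ?_ (h3.trans (map_zero (TensorProduct.congr T (LinearEquiv.refl ℝ ℝ))))
    refine congrArg (wedgeTwo B' k θ) ?_
    funext i
    exact (g.apply_symm_apply _).symm

theorem flat_eq (u : V) : flat B' (g u) = g.arrowCongr T (flat B u) := by
  ext v
  obtain ⟨v, rfl⟩ := g.surjective v
  rw [LinearEquiv.arrowCongr_apply, g.symm_apply_apply]
  exact hB u v

/-- The maps `flat B` and `flat B'` are conjugate, so they are bijective simultaneously. If they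
are, their inverses correspond; otherwise both values are the default `0`. -/
theorem flatInv_eq (a : V →ₗ[ℝ] W) : flatInv B' (g.arrowCongr T a) = g (flatInv B a) := by
  have h1 : ⇑(flat B') ∘ g = g.arrowCongr T ∘ flat B := funext fun u => flat_eq hB u
  have h2 : Function.Bijective (flat B') ↔ Function.Bijective (flat B) := by
    rw [← Function.Bijective.of_comp_iff _ g.bijective, h1,
      Function.Bijective.of_comp_iff' (g.arrowCongr T).bijective]
  by_cases h3 : Function.Bijective (flat B)
  · have h4 := h2.2 h3
    rw [flatInv, dif_pos h4, flatInv, dif_pos h3]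
    refine (LinearEquiv.symm_apply_eq _).2 ?_
    refine Eq.trans ?_ (flat_eq hB _).symm
    refine congrArg _ ?_
    exact ((LinearEquiv.ofBijective (flat B) h3).apply_symm_apply a).symm
  · rw [flatInv, dif_neg (fun h => h3 (h2.1 h)), flatInv, dif_neg h3]
    simp

/-- The two endomorphisms are conjugate under `g`, and the trace does not change under conjugation.
-/
theorem insertInv_eq (θ : V' [⋀^Fin (k + 2)]→ₗ[ℝ] ℝ) (v : Fin k → V) (s : W) :
    insertInv B' θ (fun i => g (v i)) (T s) =
      insertInv B (θ.compLinearMap g.toLinearMap) v s := by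
  rw [insertInv, insertInv, ← LinearMap.trace_conj' _ g]
  congr 1
  ext u
  obtain ⟨u, rfl⟩ := g.surjective u
  rw [LinearEquiv.conj_apply_apply, g.symm_apply_apply, LinearMap.comp_apply, LinearMap.comp_apply,
    ← flatInv_eq hB]
  refine congrArg (flatInv B') ?_
  ext w
  obtain ⟨w, rfl⟩ := g.surjective w
  rw [LinearEquiv.arrowCongr_apply, g.symm_apply_apply]
  refine Eq.trans ?_ (T.map_smul _ s).symm
  refine congrArg (fun r => θ r • T s) ?_
  funext i
  refine Fin.cases rfl (fun i => ?_) i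
  refine Fin.cases rfl (fun i => rfl) i

theorem mem_insertKer_iff (θ : V' [⋀^Fin k]→ₗ[ℝ] ℝ) :
    θ ∈ insertKer B' k ↔ θ.compLinearMap g.toLinearMap ∈ insertKer B k := by
  match k, θ with
  | 0, _ => exact iff_of_true trivial trivial
  | 1, _ => exact iff_of_true trivial trivial
  | k + 2, θ =>
    constructor
    · intro h1 v s
      rw [← insertInv_eq hB]
      exact h1 _ _
    · intro h1 v s
      have h2 := h1 (fun i => g.symm (v i)) (T.symm s)
      rw [← insertInv_eq hB] at h2
      simpa using h2

theorem mem_primitive_iff (n : ℕ) (θ : V' [⋀^Fin k]→ₗ[ℝ] ℝ) :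
    θ ∈ primitive n B' k ↔ θ.compLinearMap g.toLinearMap ∈ primitive n B k := by
  unfold primitive
  split_ifs
  · exact mem_insertKer_iff hB θ
  · exact wedgeTwo_eq_zero_iff hB θ

end Naturality

/-- Needed for `n = 0`: there the line `ℓ` degenerates to zero, while `Q` is still a line, so no
isomorphism of value spaces relates `𝛀` to the Levi bracket. On a zero space forms of positive
degree vanish, and in degree zero nothing is required. -/
theorem primitive_zero_eq_top {V W : Type*} [AddCommGroup V] [Module ℝ V] [AddCommGroup W]
    [Module ℝ W] [Subsingleton V] (B : V [⋀^Fin 2]→ₗ[ℝ] W) (k : ℕ) : primitive 0 B k = ⊤ := by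
  unfold primitive
  split_ifs with hk
  · obtain rfl : k = 0 := by omega
    rfl
  · rw [eq_top_iff]
    intro θ _
    have h1 : θ = 0 := by
      ext v
      exact θ.map_coord_zero ⟨0, by omega⟩ (Subsingleton.elim _ _)
    rw [h1]
    exact zero_mem _

theorem eq_vec_two {A : Type*} (v : Fin 2 → A) : v = ![v 0, v 1] := by
  funext i; fin_cases i <;> rfl

theorem exists_linearEquiv_of_span {L : Type*} [AddCommGroup L] [Module ℝ L] {w : L} (hw : w ≠ 0)
    (hspan : ∀ θ : L, ∃ r : ℝ, r • w = θ) : ∃ e : ℝ ≃ₗ[ℝ] L, ∀ r, e r = r • w :=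
  ⟨LinearEquiv.ofBijective (LinearMap.toSpanSingleton ℝ L w)
    ⟨smul_left_injective ℝ hw, hspan⟩, fun _ => rfl⟩

/-! ### The Levi bracket and the induced conformally symplectic structure -/

section LeviForm

variable {E : Type*} [NormedAddCommGroup E] [NormedSpace ℝ E] [FiniteDimensional ℝ E]
  {N : Type*} [TopologicalSpace N] [ChartedSpace E N] [IsManifold 𝓘(ℝ, E) ∞ N]
  {E' : Type*} [NormedAddCommGroup E'] [NormedSpace ℝ E'] [FiniteDimensional ℝ E']
  {M : Type*} [TopologicalSpace M] [ChartedSpace E' M] [IsManifold 𝓘(ℝ, E') ∞ M]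
  {H : ∀ x : N, Submodule ℝ (TangentSpace 𝓘(ℝ, E) x)} {ξ : ∀ x : N, TangentSpace 𝓘(ℝ, E) x}
  {q : N → M} {α : ∀ x : N, TangentSpace 𝓘(ℝ, E) x →ₗ[ℝ] ℝ}
  {G : ∀ x : N, H x ≃ₗ[ℝ] TangentSpace 𝓘(ℝ, E') (q x)} {k : ℕ}

theorem contMDiffAt_mlieBracket {X Y : ∀ x : N, TangentSpace 𝓘(ℝ, E) x} {x : N}
    (hX : ContMDiffAt 𝓘(ℝ, E) 𝓘(ℝ, E).tangent ∞
      (fun x => (⟨x, X x⟩ : TangentBundle 𝓘(ℝ, E) N)) x)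
    (hY : ContMDiffAt 𝓘(ℝ, E) 𝓘(ℝ, E).tangent ∞
      (fun x => (⟨x, Y x⟩ : TangentBundle 𝓘(ℝ, E) N)) x) :
    ContMDiffAt 𝓘(ℝ, E) 𝓘(ℝ, E).tangent ∞
      (fun x => (⟨x, VectorField.mlieBracket 𝓘(ℝ, E) X Y x⟩ : TangentBundle 𝓘(ℝ, E) N)) x := by
  have : IsManifold 𝓘(ℝ, E) (minSmoothness ℝ 2) N := IsManifold.of_le (n := ∞) (by
    rw [minSmoothness_of_isRCLikeNormedField]; exact WithTop.coe_le_coe.2 le_top)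
  have : IsManifold 𝓘(ℝ, E) (((⊤ : ℕ∞) : WithTop ℕ∞) + 1) N := ‹IsManifold 𝓘(ℝ, E) ∞ N›
  exact ContMDiffAt.mlieBracket_vectorField (n := ⊤) (m := ⊤) hX hY (by simp)

/-- If no Levi bracket existed, `leviBracket` would be the default `0`, which is degenerate on a
nontrivial space. -/
theorem isLeviBracketAt_leviBracket {x : N} [Nontrivial (H x)]
    (hx : Nondegenerate (leviBracket H x)) : IsLeviBracketAt H x (leviBracket H x) := by
  by_cases h1 : ∃ B, IsLeviBracketAt H x B
  · rw [leviBracket, dif_pos h1]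
    exact h1.choose_spec
  · rw [leviBracket, dif_neg h1] at hx
    obtain ⟨u, hu⟩ := exists_ne (0 : H x)
    exact absurd (hx u fun w => rfl) hu

namespace IsConnection

variable (h : IsConnection H ξ q α G)
include h

/-- The isomorphism `T_x N / H_x ≃ ℝ` induced by the connection form. -/
theorem exists_quotientEquiv (x : N) : ∃ a : (TangentSpace 𝓘(ℝ, E) x ⧸ H x) ≃ₗ[ℝ] ℝ,
    ∀ v, a ((H x).mkQ v) = α x v := by
  let a : (TangentSpace 𝓘(ℝ, E) x ⧸ H x) →ₗ[ℝ] ℝ := (H x).liftQ (α x) (h.ker_form x).ge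
  have ha : Function.Bijective a := by
    refine ⟨?_, fun r => ⟨(H x).mkQ (r • ξ x), ?_⟩⟩
    · rw [← LinearMap.ker_eq_bot]
      exact Submodule.ker_liftQ_eq_bot _ _ _ (h.ker_form x).le
    · change α x (r • ξ x) = r
      rw [map_smul, h.form_apply, smul_eq_mul, mul_one]
  exact ⟨LinearEquiv.ofBijective a ha, fun v => rfl⟩

/-- The two-form `α ∘ 𝓛` descends. -/
theorem exists_levi_descent (hL : ∀ x, IsLeviBracketAt H x (leviBracket H x)) :
    ∃ φ ∈ Omega E' M 2, ∀ (x : N) (a : (TangentSpace 𝓘(ℝ, E) x ⧸ H x) ≃ₗ[ℝ] ℝ),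
      (∀ v, a ((H x).mkQ v) = α x v) → ∀ u v : H x,
        φ (q x) ![G x u, G x v] = a (leviBracket H x ![u, v]) := by
  choose a ha using h.exists_quotientEquiv
  let σ : ∀ x : N, H x [⋀^Fin 2]→ₗ[ℝ] ℝ := fun x =>
    (a x).toLinearMap.compAlternatingMap (leviBracket H x)
  have hσ : ∀ {U : Set N} {X : Fin 2 → ∀ x : N, H x}, IsOpen U → (∀ i, SmoothSec H U (X i)) →
      ∀ x ∈ U, (σ x fun i => X i x) = α x (VectorField.mlieBracket 𝓘(ℝ, E)
        (fun y => (X 0 y : TangentSpace 𝓘(ℝ, E) y))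
        (fun y => (X 1 y : TangentSpace 𝓘(ℝ, E) y)) x) := by
    intro U X hU hX x hx
    rw [← ha, ← hL x U (X 0) (X 1) hU hx (hX 0) (hX 1), eq_vec_two fun i => X i x]
    rfl
  obtain ⟨φ, hφ, hr⟩ : ∃ φ ∈ Omega E' M 2, restrict H 2 (pullback E' q 2 φ) = σ := by
    refine h.exists_descent ?_ ?_
    · intro U X hU hX x hx
      refine ContMDiffAt.contMDiffWithinAt ?_
      refine (h.contMDiffAt_form (contMDiffAt_mlieBracket (SmoothVF.contMDiffAt (hX 0) hU hx)
        (SmoothVF.contMDiffAt (hX 1) hU hx))).congr_of_eventuallyEq ?_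
      filter_upwards [hU.mem_nhds hx] with y hy using hσ hU hX y hy
    · intro V Y hV hY x hx
      have hU := hV.preimage h.continuous
      have hX := fun i => h.smoothSec_hlift hV (hY i)
      let X : Fin 2 → ∀ x : N, TangentSpace 𝓘(ℝ, E) x := fun i x => hlift G (Y i) x
      have hXs : ∀ i, SmoothVF (q ⁻¹' V) (X i) := hX
      have h1 : (fun z => σ z fun i => hlift G (Y i) z) =ᶠ[𝓝 x]
          fun z => α z (VectorField.mlieBracket 𝓘(ℝ, E) (X 0) (X 1) z) := by
        filter_upwards [hU.mem_nhds hx] with y hy using hσ hU hX y hy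
      refine (DFunLike.congr_fun h1.mfderiv_eq (ξ x)).trans ?_
      refine (h.mvfderiv_form hU (fun y hy => (contMDiffAt_mlieBracket
        ((hXs 0).contMDiffAt hU hy) ((hXs 1).contMDiffAt hU hy)).contMDiffWithinAt) hx).trans ?_
      -- These brackets vanish on a neighbourhood, not only at `x`, so the outer brackets in the
      -- Jacobi identity for `[ξ, [X 0, X 1]]` vanish as well.
      have h2 : ∀ i, VectorField.mlieBracket 𝓘(ℝ, E) ξ (X i) =ᶠ[𝓝 x] 0 := fun i => by
        filter_upwards [hU.mem_nhds hx] with y hy using h.mlieBracket_hlift hV (hY i) hy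
      have h3 : VectorField.mlieBracket 𝓘(ℝ, E) ξ
          (VectorField.mlieBracket 𝓘(ℝ, E) (X 0) (X 1)) x = 0 := by
        have hs : minSmoothness ℝ 2 ≤ ∞ := by
          rw [minSmoothness_of_isRCLikeNormedField]; exact WithTop.coe_le_coe.2 le_top
        have : IsManifold 𝓘(ℝ, E) (minSmoothness ℝ 3) N := IsManifold.of_le (n := ∞) (by
          rw [minSmoothness_of_isRCLikeNormedField]; exact WithTop.coe_le_coe.2 le_top)
        rw [VectorField.leibniz_identity_mlieBracket_apply
          ((h.isTransversalAut.smooth.contMDiffAt isOpen_univ trivial).of_le hs)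
          (((hXs 0).contMDiffAt hU hx).of_le hs) (((hXs 1).contMDiffAt hU hx).of_le hs)]
        refine (congrArg₂ (· + ·)
          ((h2 0).mlieBracket_vectorField_eq (I := 𝓘(ℝ, E)) (Filter.EventuallyEq.refl _ (X 1)))
          ((Filter.EventuallyEq.refl _ (X 0)).mlieBracket_vectorField_eq (I := 𝓘(ℝ, E))
            (h2 1))).trans ?_
        exact (congrArg₂ (· + ·) (congrFun VectorField.mlieBracket_zero_left x)
          (congrFun VectorField.mlieBracket_zero_right x)).trans (add_zero _)
      rw [h3, map_zero]
  refine ⟨φ, hφ, fun x b hb u v => ?_⟩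
  have h1 := DFunLike.congr_fun ((h.restrict_pullback_apply φ x).symm.trans (congrFun hr x)) ![u, v]
  have h2 : b = a x := by
    ext s
    obtain ⟨v, rfl⟩ := (H x).mkQ_surjective s
    rw [hb, ha]
  rw [h2]
  refine Eq.trans ?_ h1
  refine congrArg (φ (q x)) ?_
  exact (eq_vec_two fun i => G x (![u, v] i)).symm

/-- Under `T_x q`, the form of the induced conformally symplectic structure is the Levi bracket. -/
theorem exists_csForm_equiv (hL : ∀ x, IsLeviBracketAt H x (leviBracket H x)) (x : N)
    (hx : leviBracket H x ≠ 0) :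
    ∃ T : (TangentSpace 𝓘(ℝ, E) x ⧸ H x) ≃ₗ[ℝ] (csLine E' H q (q x) →ₗ[ℝ] ℝ),
      ∀ u v, csForm E' H q (q x) ![G x u, G x v] = T (leviBracket H x ![u, v]) := by
  obtain ⟨φ, -, hφ⟩ := h.exists_levi_descent hL
  obtain ⟨a, ha⟩ := h.exists_quotientEquiv x
  have hmem : φ (q x) ∈ csLine E' H q (q x) := by
    -- The base point is a variable here so that the transport along `hx'` can be eliminated.
    have key : ∀ y (x' : N) (hx' : q x' = y),
        ∃ c : (TangentSpace 𝓘(ℝ, E) x' ⧸ H x') →ₗ[ℝ] ℝ, ∀ u v : H x',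
          φ y ![hx' ▸ mfderiv 𝓘(ℝ, E) 𝓘(ℝ, E') q x' u, hx' ▸ mfderiv 𝓘(ℝ, E) 𝓘(ℝ, E') q x' v] =
            c (leviBracket H x' ![u, v]) := by
      rintro _ x' rfl
      obtain ⟨a', ha'⟩ := h.exists_quotientEquiv x'
      refine ⟨a'.toLinearMap, fun u v => ?_⟩
      refine Eq.trans ?_ (hφ x' a' ha' u v)
      rw [h.lift_apply, h.lift_apply]
    exact key (q x)
  let w : csLine E' H q (q x) := ⟨φ (q x), hmem⟩
  have hw : ∀ u v, w.1 ![G x u, G x v] = a (leviBracket H x ![u, v]) := hφ x a ha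
  have hw0 : w ≠ 0 := by
    intro hw0
    refine hx ?_
    ext v
    rw [eq_vec_two v]
    refine a.map_eq_zero_iff.1 ?_
    rw [← hw, hw0]
    rfl
  have hspan : ∀ θ : csLine E' H q (q x), ∃ r : ℝ, r • w = θ := by
    intro θ
    obtain ⟨c, hc⟩ := θ.2 x rfl
    -- The quotient is a line with coordinate `a`, so `c` is `c (a.symm 1)` times `a`.
    refine ⟨c (a.symm 1), Subtype.ext ?_⟩
    ext v
    have h1 : v = ![G x ((G x).symm (v 0)), G x ((G x).symm (v 1))] := by
      rw [(G x).apply_symm_apply, (G x).apply_symm_apply]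
      exact eq_vec_two v
    rw [h1]
    have h2 := hc ((G x).symm (v 0)) ((G x).symm (v 1))
    rw [← h.lift_apply, ← h.lift_apply] at h2
    refine Eq.trans ?_ h2.symm
    refine (congrArg (c (a.symm 1) * ·) (hw _ _)).trans ?_
    set s := leviBracket H x ![(G x).symm (v 0), (G x).symm (v 1)]
    have h3 : s = a s • a.symm 1 := by
      rw [← map_smul, smul_eq_mul, mul_one, a.symm_apply_apply]
    conv_rhs => rw [h3, map_smul, smul_eq_mul, mul_comm]
  obtain ⟨e, he⟩ := exists_linearEquiv_of_span (L := csLine E' H q (q x)) hw0 hspan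
  -- The value of `T` at `s` is the linear form on `ℓ` that takes the value `a s` on the generator
  -- `w`.
  refine ⟨a ≪≫ₗ (LinearMap.ringLmapEquivSelf ℝ ℝ ℝ).symm ≪≫ₗ e.arrowCongr (LinearEquiv.refl ℝ ℝ),
    fun u v => ?_⟩
  ext θ
  obtain ⟨r, rfl⟩ := e.surjective θ
  have h1 : csForm E' H q (q x) ![G x u, G x v] (e r) = r * w.1 ![G x u, G x v] :=
    congrArg (fun θ : csLine E' H q (q x) => θ.1 ![G x u, G x v]) (he r)
  rw [h1, hw]
  simp [LinearEquiv.arrowCongr_apply]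

/-- The tracefree parts over `x` and `q x` correspond to each other. -/
theorem mem_primitive_csForm_iff {n : ℕ} (hn : Module.finrank ℝ E' = 2 * n)
    (hL : ∀ x, Nondegenerate (leviBracket H x)) (x : N)
    (θ : TangentSpace 𝓘(ℝ, E') (q x) [⋀^Fin k]→ₗ[ℝ] ℝ) :
    θ ∈ primitive n (csForm E' H q (q x)) k ↔
      θ.compLinearMap (G x).toLinearMap ∈ primitive n (leviBracket H x) k := by
  rcases Nat.eq_zero_or_pos n with rfl | hn0
  · have : Subsingleton (TangentSpace 𝓘(ℝ, E') (q x)) :=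
      (Module.finrank_zero_iff (R := ℝ) (M := E')).1 (by simpa using hn)
    have : Subsingleton (H x) := (G x).toEquiv.subsingleton
    rw [primitive_zero_eq_top, primitive_zero_eq_top]
    exact iff_of_true trivial trivial
  · have hnt : ∀ x, Nontrivial (H x) := fun x => by
      have : Nontrivial (TangentSpace 𝓘(ℝ, E') (q x)) :=
        Module.nontrivial_of_finrank_pos (R := ℝ) (M := E') (by omega)
      exact (G x).toEquiv.nontrivial
    have hL' : ∀ x, IsLeviBracketAt H x (leviBracket H x) := fun x =>
      isLeviBracketAt_leviBracket (hL x)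
    have hx : leviBracket H x ≠ 0 := by
      intro h0
      obtain ⟨u, hu⟩ := exists_ne (0 : H x)
      exact hu (hL x u fun w => by rw [h0]; rfl)
    obtain ⟨T, hT⟩ := h.exists_csForm_equiv hL' x hx
    exact mem_primitive_iff hT n θ

end IsConnection
end LeviForm

/-! ### Existence and uniqueness of the connection form -/

section Existence

/-- A linear form that vanishes on `P` but not at `u` has a kernel of codimension one, which must be
`P`; it is then normalized at `u`. -/
theorem exists_form_of_complement {V : Type*} [AddCommGroup V] [Module ℝ V] [FiniteDimensional ℝ V]
    {P : Submodule ℝ V} {u : V} (hu : u ∉ P)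
    (hP : Module.finrank ℝ V = Module.finrank ℝ P + 1) :
    ∃ a : V →ₗ[ℝ] ℝ, LinearMap.ker a = P ∧ a u = 1 := by
  obtain ⟨f, hfu, hf⟩ := Submodule.exists_le_ker_of_notMem hu
  refine ⟨(f u)⁻¹ • f, ?_, by simp [hfu]⟩
  rw [LinearMap.ker_smul _ _ (inv_ne_zero hfu)]
  refine (Submodule.eq_of_le_of_finrank_eq hf ?_).symm
  have h1 := f.finrank_range_add_finrank_ker
  rw [LinearMap.range_eq_top.2 (LinearMap.surjective fun h0 => hfu (by rw [h0]; rfl)),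
    finrank_top, Module.finrank_self] at h1
  omega

variable {E : Type*} [NormedAddCommGroup E] [NormedSpace ℝ E] [FiniteDimensional ℝ E]
  {N : Type*} [TopologicalSpace N] [ChartedSpace E N] [IsManifold 𝓘(ℝ, E) ∞ N]
  {E' : Type*} [NormedAddCommGroup E'] [NormedSpace ℝ E'] [FiniteDimensional ℝ E']
  {M : Type*} [TopologicalSpace M] [ChartedSpace E' M] [IsManifold 𝓘(ℝ, E') ∞ M]
  {H : ∀ x : N, Submodule ℝ (TangentSpace 𝓘(ℝ, E) x)} {ξ : ∀ x : N, TangentSpace 𝓘(ℝ, E) x}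
  {q : N → M} {α : ∀ x : N, TangentSpace 𝓘(ℝ, E) x →ₗ[ℝ] ℝ}
  {G : ∀ x : N, H x ≃ₗ[ℝ] TangentSpace 𝓘(ℝ, E') (q x)}

theorem IsDistribution.finrank_eq {r : ℕ} (hH : IsDistribution H r) (x : N) :
    Module.finrank ℝ (H x) = r := by
  obtain ⟨U, -, hx, X, -, hX⟩ := hH x
  have h1 := finrank_span_eq_card (hX x hx).1
  rw [(hX x hx).2, Fintype.card_fin] at h1
  exact h1

/-- The form is chosen pointwise; its smoothness follows afterwards from `contMDiffAt_form`. The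
derivative of `q` is injective on `H_x`, since its kernel `ℝξ` meets `H_x` only in zero, and then
bijective by dimension. -/
theorem exists_isConnection (hH : IsDistribution H (Module.finrank ℝ E'))
    (hξ : IsTransversalAut H ξ) (hq : IsQuotient E' ξ q)
    (hE : Module.finrank ℝ E = Module.finrank ℝ E' + 1) :
    ∃ (α : ∀ x : N, TangentSpace 𝓘(ℝ, E) x →ₗ[ℝ] ℝ)
      (G : ∀ x : N, H x ≃ₗ[ℝ] TangentSpace 𝓘(ℝ, E') (q x)), IsConnection H ξ q α G := by
  have hfd : ∀ x : N, FiniteDimensional ℝ (TangentSpace 𝓘(ℝ, E) x) := fun _ =>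
    ‹FiniteDimensional ℝ E›
  have hfd' : ∀ y : M, FiniteDimensional ℝ (TangentSpace 𝓘(ℝ, E') y) := fun _ =>
    ‹FiniteDimensional ℝ E'›
  choose α hα hαξ using fun x => exists_form_of_complement (hξ.transversal x)
    (by rw [hH.finrank_eq]; exact hE)
  let g : ∀ x : N, H x →ₗ[ℝ] TangentSpace 𝓘(ℝ, E') (q x) := fun x =>
    (mfderiv 𝓘(ℝ, E) 𝓘(ℝ, E') q x).toLinearMap ∘ₗ (H x).subtype
  have hg : ∀ x, Function.Bijective (g x) := by
    intro x
    have hinj : Function.Injective (g x) := by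
      rw [injective_iff_map_eq_zero]
      intro v hv
      have h1 : (v : TangentSpace 𝓘(ℝ, E) x) ∈
        LinearMap.ker (mfderiv 𝓘(ℝ, E) 𝓘(ℝ, E') q x).toLinearMap := hv
      rw [hq.ker_eq, Submodule.mem_span_singleton] at h1
      obtain ⟨c, hc⟩ := h1
      have h2 : α x (c • ξ x) = 0 := by
        rw [hc, ← LinearMap.mem_ker, hα]
        exact v.2
      rw [map_smul, hαξ, smul_eq_mul, mul_one] at h2
      rw [h2, zero_smul] at hc
      exact Subtype.ext hc.symm
    exact ⟨hinj, (LinearMap.injective_iff_surjective_of_finrank_eq_finrank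
      (hH.finrank_eq x)).1 hinj⟩
  exact ⟨α, fun x => LinearEquiv.ofBijective (g x) (hg x), hH, hξ, hq, hα, hαξ,
    fun x v => rfl, hE⟩

/-- Both forms vanish on `v - α(v) ξ`, which lies in `H`, and both are 1 on `ξ`. -/
theorem IsConnection.eq_of_isContactForm (h : IsConnection H ξ q α G)
    {β : ∀ x : N, TangentSpace 𝓘(ℝ, E) x →ₗ[ℝ] ℝ} (hβ : IsContactForm H β)
    (hβξ : ∀ x, β x (ξ x) = 1) : β = α := by
  funext x
  ext v
  have h1 : β x (v - α x v • ξ x) = 0 := by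
    rw [← LinearMap.mem_ker, hβ.2]
    exact h.sub_smul_mem x v
  rw [map_sub, map_smul, hβξ, smul_eq_mul, mul_one] at h1
  exact sub_eq_zero.1 h1

end Existence

end ContactQuotient

end

open ContactQuotient in
theorem proposition2p3 (n : ℕ)
    {N : Type*} [TopologicalSpace N] [T2Space N] [SecondCountableTopology N]
    [ChartedSpace (EuclideanSpace ℝ (Fin (2 * n + 1))) N] [IsManifold (𝓡 (2 * n + 1)) ∞ N]
    {M : Type*} [TopologicalSpace M] [T2Space M] [SecondCountableTopology M]
    [ChartedSpace (EuclideanSpace ℝ (Fin (2 * n))) M] [IsManifold (𝓡 (2 * n)) ∞ M]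
    (H : ∀ x : N, Submodule ℝ (TangentSpace (𝓡 (2 * n + 1)) x)) (hH : IsContact H n)
    (ξ : ∀ x : N, TangentSpace (𝓡 (2 * n + 1)) x) (hξ : IsTransversalAut H ξ)
    (q : N → M) (hq : IsQuotient (EuclideanSpace ℝ (Fin (2 * n))) ξ q) :
    ∃ α : ∀ x : N, TangentSpace (𝓡 (2 * n + 1)) x →ₗ[ℝ] ℝ,
      (IsContactForm H α ∧ ∀ x, α x (ξ x) = 1) ∧
      (∀ β : ∀ x : N, TangentSpace (𝓡 (2 * n + 1)) x →ₗ[ℝ] ℝ,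
        IsContactForm H β → (∀ x, β x (ξ x) = 1) → β = α) ∧
      (∀ k : ℕ,
        Set.BijOn (restrict H k ∘ₗ pullback (EuclideanSpace ℝ (Fin (2 * n))) q k)
          (Omega (EuclideanSpace ℝ (Fin (2 * n))) M k)
          {σ | σ ∈ GammaH H k ∧ IsLieDerivH H ξ σ 0} ∧
        Set.BijOn (restrict H k ∘ₗ pullback (EuclideanSpace ℝ (Fin (2 * n))) q k)
          (Omega0 (EuclideanSpace ℝ (Fin (2 * n))) H q n k)
          {σ | σ ∈ GammaH0 H n k ∧ IsLieDerivH H ξ σ 0} ∧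
        Set.BijOn (wedge α k ∘ₗ pullback (EuclideanSpace ℝ (Fin (2 * n))) q k)
          (Omega (EuclideanSpace ℝ (Fin (2 * n))) M k)
          {ψ | ψ ∈ GammaHQ H k ∧ IsLieDeriv ξ ψ 0} ∧
        Set.BijOn (wedge α k ∘ₗ pullback (EuclideanSpace ℝ (Fin (2 * n))) q k)
          (Omega0 (EuclideanSpace ℝ (Fin (2 * n))) H q n k)
          {ψ | ψ ∈ GammaHQ0 H n k ∧ IsLieDeriv ξ ψ 0}) ∧
      (Set.BijOn (pullback (EuclideanSpace ℝ (Fin (2 * n))) q 0)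
        (Omega (EuclideanSpace ℝ (Fin (2 * n))) M 0)
        {ψ | ψ ∈ Omega (EuclideanSpace ℝ (Fin (2 * n + 1))) N 0 ∧ IsLieDeriv ξ ψ 0}) ∧
      (∀ k : ℕ,
        Set.BijOn ((pullback (EuclideanSpace ℝ (Fin (2 * n))) q (k + 1)).coprod (wedge α k ∘ₗ
            pullback (EuclideanSpace ℝ (Fin (2 * n))) q k))
          ((Omega (EuclideanSpace ℝ (Fin (2 * n))) M (k + 1)).prod
            (Omega (EuclideanSpace ℝ (Fin (2 * n))) M k))
          {ψ | ψ ∈ Omega (EuclideanSpace ℝ (Fin (2 * n + 1))) N (k + 1) ∧ IsLieDeriv ξ ψ 0}) := by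
  have hE' : Module.finrank ℝ (EuclideanSpace ℝ (Fin (2 * n))) = 2 * n := finrank_euclideanSpace_fin
  have hE : Module.finrank ℝ (EuclideanSpace ℝ (Fin (2 * n + 1))) = 2 * n + 1 :=
    finrank_euclideanSpace_fin
  have hD : IsDistribution H (Module.finrank ℝ (EuclideanSpace ℝ (Fin (2 * n)))) := by
    rw [hE']; exact hH.isDistribution
  obtain ⟨α, G, h⟩ := exists_isConnection hD hξ hq (by rw [hE, hE'])
  have hprim := fun (k : ℕ) (x : N) => h.mem_primitive_csForm_iff (k := k) hE' hH.nondegenerate x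
  exact ⟨α, ⟨h.isContactForm, h.form_apply⟩, fun β hβ hβξ => h.eq_of_isContactForm hβ hβξ,
    fun k => ⟨h.bijOn_restrict_pullback k, h.bijOn_restrict_pullback_primitive (hprim k),
      h.bijOn_wedge_pullback k, h.bijOn_wedge_pullback_primitive (hprim k)⟩,
    h.bijOn_pullback_zero, h.bijOn_coprod⟩
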